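/- All groups are finite. For a positive integer $n$ let $\pi(n)$ be the set of prime divisors of $n$, and for a group $G$ let $\pi(G)=\pi(|G|)$. A directed graph $\Gamma$ is a pair consisting of a vertex set $V(\Gamma)$ and an edge set $E(\Gamma)\subseteq V(\Gamma)\times V(\Gamma)$ (loops allowed); $\Gamma_1\subseteq\Gamma_2$ means $V(\Gamma_1)\subseteq V(\Gamma_2)$ and $E(\Gamma_1)\subseteq E(\Gamma_2)$, and unions are formed by taking unions of vertex sets and of edge sets. A graph given only by a set of edges has the endpoints of these edges as its vertices. A Schmidt $(p,q)$-group is a non-nilpotent group $S$ all of whose proper subgroups are nilpotent, such that $\pi(S)=\{p,q\}$ and $S$ has a normal Sylow $p$-subgroup. The $N$-critical graph $\Gamma_{Nc}(G)$ has vertex set $\pi(G)$, and $(p,q)$ is an edge if and only if $G$ has a subgroup which is a Schmidt $(p,q)$-group. The Hawkes graph $\Gamma_H(G)$ has vertex set $\pi(G)$, and for $p\in\pi(G)$ the pair $(p,q)$ is an edge if and only if $q\in\pi(G/\mathrm{O}_{p',p}(G))$; here $\mathrm{O}_{p'}(G)$ is the greatest normal subgroup of $G$ of order prime to $p$, $\mathrm{O}_p(G)$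 is the greatest normal $p$-subgroup of $G$, and $\mathrm{O}_{p',p}(G)$ is defined by $\mathrm{O}_{p',p}(G)/\mathrm{O}_{p'}(G)=\mathrm{O}_p(G/\mathrm{O}_{p'}(G))$. **Theorem.** Let a finite group $G=AB$ be the mutually permutable product of its subgroups $A$ and $B$; that is, $G=AB$, $A$ permutes with every subgroup of $B$ ($AK=KA$ for all $K\le B$), and $B$ permutes with every subgroup of $A$. Let $\Gamma(A,B)$ be the graph given by the set of edges $$\{(p,q)\mid p\in\pi(A),\ q\in\pi(B)\cap\pi(p-1)\ \text{ or }\ p\in\pi(B),\ q\in\pi(A)\cap\pi(p-1)\}.$$ Then $$\Gamma_{Nc}(A)\cup\Gamma_{Nc}(B)\subseteq\Gamma_{Nc}(G)\subseteq\Gamma_{Nc}(A)\cup\Gamma_{Nc}(B)\cup\Gamma(A,B)$$ and $$\Gamma_H(A)\cup\Gamma_H(B)\subseteq\Gamma_H(G)\subseteq\Gamma_H(A)\cup\Gamma_H(B)\cup\Gamma(A,B)\cup\{(p,p)\mid p\in\pi(G)\}.$$ -/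

import Mathlib

open scoped Pointwise

/-- A directed graph: a vertex set together with a set of ordered pairs of vertices
(loops are allowed). -/
@[ext]
structure DirectedGraph (α : Type*) where
  verts : Set α
  edges : Set (α × α)
  edges_mem : ∀ e ∈ edges, e.1 ∈ verts ∧ e.2 ∈ verts

namespace DirectedGraph

/-- `Γ₁` is a subgraph of `Γ₂`: inclusion of both the vertex sets and the edge sets. -/
instance {α : Type*} : HasSubset (DirectedGraph α) :=
  ⟨fun Γ₁ Γ₂ => Γ₁.verts ⊆ Γ₂.verts ∧ Γ₁.edges ⊆ Γ₂.edges⟩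

/-- The union of two directed graphs: union of the vertex sets and of the edge sets. -/
instance {α : Type*} : Union (DirectedGraph α) :=
  ⟨fun Γ₁ Γ₂ =>
    { verts := Γ₁.verts ∪ Γ₂.verts
      edges := Γ₁.edges ∪ Γ₂.edges
      edges_mem := by
        rintro e (he | he)
        · exact ⟨Or.inl (Γ₁.edges_mem e he).1, Or.inl (Γ₁.edges_mem e he).2⟩
        · exact ⟨Or.inr (Γ₂.edges_mem e he).1, Or.inr (Γ₂.edges_mem e he).2⟩ }⟩

/-- The directed graph without isolated vertices that is given by its set of edges:
its vertices are the endpoints of the edges. -/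
def ofEdges {α : Type*} (E : Set (α × α)) : DirectedGraph α where
  verts := {v | ∃ e ∈ E, v = e.1 ∨ v = e.2}
  edges := E
  edges_mem := fun e he => ⟨⟨e, he, Or.inl rfl⟩, ⟨e, he, Or.inr rfl⟩⟩

end DirectedGraph

/-- `π(G)`, the set of all prime divisors of the order of `G`. -/
def primeDivisors (G : Type*) : Set ℕ := {p | p ∈ (Nat.card G).primeFactors}

/-- `G` is a `π`-group: every prime divisor of its order lies in `π`. -/
def IsPiGroup (π : Set ℕ) (G : Type*) : Prop := primeDivisors G ⊆ π

/-- `O_π(G)`, the greatest normal `π`-subgroup of `G`, as the subgroup generated by all normal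
`π`-subgroups of `G`. -/
def piCore (π : Set ℕ) (G : Type*) [Group G] : Subgroup G :=
  sSup {N : Subgroup G | N.Normal ∧ IsPiGroup π N}

instance piCore_normal (π : Set ℕ) (G : Type*) [Group G] : (piCore π G).Normal :=
  Subgroup.sSup_normal _ fun _ hN => hN.1

/-- `O_p(G)`, the greatest normal `p`-subgroup of `G`. -/
abbrev opCore (p : ℕ) (G : Type*) [Group G] : Subgroup G := piCore {p} G

/-- `O_{p'}(G)`, the greatest normal `p'`-subgroup of `G`. -/
abbrev opPrimeCore (p : ℕ) (G : Type*) [Group G] : Subgroup G := piCore {r | r.Prime ∧ r ≠ p} G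

/-- `O_{p',p}(G)`, the subgroup of `G` that contains `O_{p'}(G)` and satisfies
`O_{p',p}(G) / O_{p'}(G) = O_p(G / O_{p'}(G))`. -/
def opPrimePCore (p : ℕ) (G : Type*) [Group G] : Subgroup G :=
  (opCore p (G ⧸ opPrimeCore p G)).comap (QuotientGroup.mk' (opPrimeCore p G))

instance opPrimePCore_normal (p : ℕ) (G : Type*) [Group G] : (opPrimePCore p G).Normal :=
  Subgroup.Normal.comap inferInstance _

/-- The Hawkes graph `Γ_H(G)`: its vertex set is `π(G)`, and `(p, q)` is an edge whenever
`p ∈ π(G)` and `q ∈ π(G / O_{p',p}(G))`. -/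
def hawkesGraph (G : Type*) [Group G] [Finite G] : DirectedGraph ℕ where
  verts := primeDivisors G
  edges := {e | e.1 ∈ primeDivisors G ∧ e.2 ∈ primeDivisors (G ⧸ opPrimePCore e.1 G)}
  edges_mem := fun _ he =>
    ⟨he.1, Nat.primeFactors_mono (Subgroup.card_quotient_dvd_card _) Nat.card_pos.ne' he.2⟩

/-- A Schmidt group: a non-nilpotent group all of whose proper subgroups are nilpotent. -/
def IsSchmidtGroup (S : Type*) [Group S] : Prop :=
  ¬ Group.IsNilpotent S ∧ ∀ H : Subgroup S, H ≠ ⊤ → Group.IsNilpotent H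

/-- A Schmidt `(p, q)`-group: a Schmidt group `S` with `π(S) = {p, q}` and a normal Sylow
`p`-subgroup. -/
def IsSchmidtPQGroup (p q : ℕ) (S : Type*) [Group S] : Prop :=
  IsSchmidtGroup S ∧ primeDivisors S = {p, q} ∧ ∃ P : Sylow p S, (P : Subgroup S).Normal

/-- The `N`-critical graph `Γ_{Nc}(G)`: its vertex set is `π(G)`, and `(p, q)` is an edge whenever
`G` contains a Schmidt `(p, q)`-subgroup. -/
def nCriticalGraph (G : Type*) [Group G] [Finite G] : DirectedGraph ℕ where
  verts := primeDivisors G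
  edges := {e | ∃ S : Subgroup G, IsSchmidtPQGroup e.1 e.2 S}
  edges_mem := by
    rintro e ⟨S, -, hS, -⟩
    have h : primeDivisors S ⊆ primeDivisors G := fun _ hr =>
      Nat.primeFactors_mono S.card_subgroup_dvd_card Nat.card_pos.ne' hr
    exact ⟨h (by simp [hS]), h (by simp [hS])⟩

/-- Two subgroups `H`, `K` permute: `HK = KH`. -/
def SubgroupsPermute {G : Type*} [Group G] (H K : Subgroup G) : Prop :=
  (H : Set G) * (K : Set G) = (K : Set G) * (H : Set G)

/-- `G` is the mutually permutable product of its subgroups `A` and `B`: `G = AB`, `A` permutes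
with every subgroup of `B`, and `B` permutes with every subgroup of `A`. -/
def IsMutuallyPermutableProduct {G : Type*} [Group G] (A B : Subgroup G) : Prop :=
  (A : Set G) * (B : Set G) = Set.univ ∧
  (∀ K : Subgroup G, K ≤ B → SubgroupsPermute A K) ∧
  (∀ H : Subgroup G, H ≤ A → SubgroupsPermute B H)

/-- The graph `Γ(A, B)`, given by its edges: the pairs `(p, q)` with `p ∈ π(A)` and
`q ∈ π(B) ∩ π(p - 1)`, or `p ∈ π(B)` and `q ∈ π(A) ∩ π(p - 1)`. -/
def productGraph (A B : Type*) : DirectedGraph ℕ :=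
  DirectedGraph.ofEdges {e |
    (e.1 ∈ primeDivisors A ∧ e.2 ∈ primeDivisors B ∧ e.2 ∈ (e.1 - 1).primeFactors) ∨
    (e.1 ∈ primeDivisors B ∧ e.2 ∈ primeDivisors A ∧ e.2 ∈ (e.1 - 1).primeFactors)}

/-- The graph of all loops `(p, p)` with `p ∈ π(G)`. -/
def loopGraph (G : Type*) : DirectedGraph ℕ :=
  DirectedGraph.ofEdges {e | e.1 ∈ primeDivisors G ∧ e.2 = e.1}

/-! Fix primes p ≠ q. There is no Schmidt (p,q)-subgroup exactly when every q-element that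
normalises a p-subgroup centralises it (`QElementsCentralize`, `exists_isSchmidtPQGroup_iff`). And q
does not divide |G : O_{p',p}(G)| exactly when G has a normal p'-subgroup of index prime to q
(`IsPPrimeByQPrime`, `dvd_index_opPrimePCore_iff`). The first property passes to subgroups, and
O_{p',p}(G) ∩ H ≤ O_{p',p}(H) for H ≤ G; this gives the lower inclusions.

For the upper inclusions, suppose A and B both have one of the two properties and (p,q) is not an
edge of Γ(A,B) (`NotLinked`). Then G has the property, by induction on |G|: everything passes to G/N
for a minimal normal subgroup N, and what remains is the action of q-elements on N.

If N is an elementary abelian p-group, Dedekind's law makes (N ∩ A)(N ∩ B) normal in G. So N equals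
this product, or N meets both factors trivially and then has prime order. In both cases a n a⁻¹ ∈ (N
∩ A)⟨n⟩ for a ∈ A, n ∈ N. Hence a q-element of A that centralises N ∩ A acts on each cyclic subgroup
of N/(N ∩ A) as a power i with i^(q^k) = 1 in F_p, and i = 1 when q ∤ p - 1. If q ∣ p - 1, the
missing edge forces one factor to have order prime to both p and q; that factor has no nontrivial
q-elements, and the other contains N.

If N is nonsoluble, each factor contains or centralises N (`le_or_commute_of_not_isSolvable`), so
the action on N is seen inside the factors. This rests on `MutuallyPermutable.perfect_le`: for
soluble L ≤ B the perfect subgroups of AL lie in A. Its proof reduces to a core-free subgroup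
complemented by a group of prime order, where counting Sylow subgroups forces solubility.
Consequently the subgroup generated by the perfect subgroups of A is normal in G, and a mutually
permutable product of soluble groups is soluble. -/

open scoped Pointwise

/-! ### Permuting subgroups: Dedekind's law and orders of products. -/

namespace SubgroupsPermute

variable {G G' : Type*} [Group G] [Group G'] {H K U : Subgroup G}

theorem symm (h : SubgroupsPermute H K) : SubgroupsPermute K H := Eq.symm h

theorem exists_mul_eq (h : SubgroupsPermute H K) {k x : G} (hk : k ∈ K) (hx : x ∈ H) :
    ∃ a ∈ H, ∃ b ∈ K, a * b = k * x := by
  have : k * x ∈ (H : Set G) * (K : Set G) := by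
    rw [h]; exact Set.mul_mem_mul hk hx
  exact Set.mem_mul.1 this

theorem of_forall (h : ∀ k ∈ K, ∀ x ∈ H, ∃ a ∈ H, ∃ b ∈ K, a * b = k * x) :
    SubgroupsPermute H K := by
  apply Set.Subset.antisymm
  · rintro _ ⟨x, hx, k, hk, rfl⟩
    obtain ⟨a, ha, b, hb, e⟩ := h k⁻¹ (K.inv_mem hk) x⁻¹ (H.inv_mem hx)
    refine ⟨b⁻¹, K.inv_mem hb, a⁻¹, H.inv_mem ha, ?_⟩
    simp only
    rw [← mul_inv_rev, e]; simp
  · rintro _ ⟨k, hk, x, hx, rfl⟩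
    obtain ⟨a, ha, b, hb, e⟩ := h k hk x hx
    exact ⟨a, ha, b, hb, e⟩

theorem mem_sup (h : SubgroupsPermute H K) {x : G} (hx : x ∈ H ⊔ K) :
    ∃ a ∈ H, ∃ b ∈ K, a * b = x := by
  let S : Subgroup G :=
    { carrier := (H : Set G) * (K : Set G)
      one_mem' := ⟨1, H.one_mem, 1, K.one_mem, by simp⟩
      mul_mem' := by
        rintro _ _ ⟨a, ha, b, hb, rfl⟩ ⟨c, hc, d, hd, rfl⟩
        obtain ⟨a', ha', b', hb', e⟩ := h.exists_mul_eq hb hc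
        refine ⟨a * a', H.mul_mem ha ha', b' * d, K.mul_mem hb' hd, ?_⟩
        simp only
        calc a * a' * (b' * d) = a * (a' * b') * d := by group
          _ = _ := by rw [e]; group
      inv_mem' := by
        rintro _ ⟨a, ha, b, hb, rfl⟩
        obtain ⟨a', ha', b', hb', e⟩ := h.exists_mul_eq (K.inv_mem hb) (H.inv_mem ha)
        exact ⟨a', ha', b', hb', by simp only; rw [e, mul_inv_rev]⟩ }
  have : H ⊔ K ≤ S := sup_le (fun y hy => ⟨y, hy, 1, K.one_mem, by simp⟩)
    (fun y hy => ⟨1, H.one_mem, y, hy, by simp⟩)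
  exact Set.mem_mul.1 (this hx)

theorem inf_right (h : SubgroupsPermute H K) (hU : H ≤ U) : SubgroupsPermute H (K ⊓ U) := by
  apply of_forall
  rintro k ⟨hk, hkU⟩ x hx
  obtain ⟨a, ha, b, hb, e⟩ := h.exists_mul_eq hk hx
  refine ⟨a, ha, b, ⟨hb, ?_⟩, e⟩
  have : b = a⁻¹ * (k * x) := by rw [← e]; group
  rw [this]
  exact U.mul_mem (U.inv_mem (hU ha)) (U.mul_mem hkU (hU hx))

theorem sup_inf_le (h : SubgroupsPermute H K) (hU : H ≤ U) : (H ⊔ K) ⊓ U ≤ H ⊔ (K ⊓ U) := by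
  rintro x ⟨hx, hxU⟩
  obtain ⟨a, ha, b, hb, rfl⟩ := h.mem_sup hx
  refine Subgroup.mul_mem_sup ha ⟨hb, ?_⟩
  simpa using U.mul_mem (U.inv_mem (hU ha)) hxU

theorem sup_inf (h : SubgroupsPermute H K) (hU : H ≤ U) : (H ⊔ K) ⊓ U = H ⊔ (K ⊓ U) :=
  le_antisymm (h.sup_inf_le hU)
    (sup_le (le_inf le_sup_left hU) (inf_le_inf_right _ le_sup_right))

theorem map (h : SubgroupsPermute H K) (f : G →* G') :
    SubgroupsPermute (H.map f) (K.map f) := by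
  unfold SubgroupsPermute at *
  rw [Subgroup.coe_map, Subgroup.coe_map, ← Set.image_mul, h, Set.image_mul]

theorem subgroupOf (h : SubgroupsPermute H K) {X : Subgroup G} (hH : H ≤ X) (hK : K ≤ X) :
    SubgroupsPermute (H.subgroupOf X) (K.subgroupOf X) := by
  apply of_forall
  rintro ⟨k, hkX⟩ hk ⟨x, hxX⟩ hx
  obtain ⟨a, ha, b, hb, e⟩ := h.exists_mul_eq (Subgroup.mem_subgroupOf.1 hk)
    (Subgroup.mem_subgroupOf.1 hx)
  exact ⟨⟨a, hH ha⟩, Subgroup.mem_subgroupOf.2 ha, ⟨b, hK hb⟩, Subgroup.mem_subgroupOf.2 hb,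
    Subtype.ext e⟩

/-- Both sides count cosets of K: those met by HK are exactly those met by H. No normality is
needed. -/
theorem relIndex_sup (h : SubgroupsPermute H K) : K.relIndex (H ⊔ K) = K.relIndex H := by
  have key : ∀ L : Subgroup G, K.relIndex L = (QuotientGroup.mk '' (L : Set G) : Set (G ⧸ K)).ncard := by
    intro L
    have e1 : K.subgroupOf L = MulAction.stabilizer L ((1 : G) : G ⧸ K) := by
      ext x
      rw [Subgroup.mem_subgroupOf, MulAction.mem_stabilizer_iff]
      change _ ↔ (((x : G) * 1 : G) : G ⧸ K) = ((1 : G) : G ⧸ K)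
      rw [eq_comm, QuotientGroup.eq]; simp
    have e2 : (QuotientGroup.mk '' (L : Set G) : Set (G ⧸ K)) =
        MulAction.orbit L ((1 : G) : G ⧸ K) := by
      ext y
      constructor
      · rintro ⟨x, hx, rfl⟩
        exact ⟨⟨x, hx⟩, by change (((x : G) * 1 : G) : G ⧸ K) = _; simp⟩
      · rintro ⟨x, rfl⟩
        exact ⟨x, x.2, by change _ = (((x : G) * 1 : G) : G ⧸ K); simp⟩
    rw [Subgroup.relIndex, e1, e2, MulAction.index_stabilizer]
  rw [key, key]
  congr 1
  ext y
  constructor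
  · rintro ⟨x, hx, rfl⟩
    obtain ⟨a, ha, b, hb, rfl⟩ := h.mem_sup hx
    exact ⟨a, ha, by rw [QuotientGroup.eq]; simpa using hb⟩
  · rintro ⟨x, hx, rfl⟩
    exact ⟨x, Subgroup.mem_sup_left hx, rfl⟩

theorem of_normal_left (H K : Subgroup G) [H.Normal] : SubgroupsPermute H K := by
  apply of_forall
  intro k hk x hx
  exact ⟨k * x * k⁻¹, Subgroup.Normal.conj_mem inferInstance x hx k, k, hk, by group⟩

theorem card_sup (h : SubgroupsPermute H K) :
    Nat.card (H ⊔ K : Subgroup G) = Nat.card K * K.relIndex H := by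
  rw [← h.relIndex_sup, ← Subgroup.relIndex_bot_left, ← Subgroup.relIndex_bot_left,
    Subgroup.relIndex_mul_relIndex _ _ _ bot_le le_sup_right]

theorem card_sup_dvd [Finite G] (h : SubgroupsPermute H K) :
    Nat.card (H ⊔ K : Subgroup G) ∣ Nat.card H * Nat.card K := by
  rw [h.card_sup, mul_comm]
  exact mul_dvd_mul_right (Subgroup.relIndex_dvd_card _ _) _

end SubgroupsPermute

/-- `A` permutes with every subgroup of `B`, and `B` permutes with every subgroup of `A`. -/
def MutuallyPermutable {G : Type*} [Group G] (A B : Subgroup G) : Prop :=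
  (∀ K : Subgroup G, K ≤ B → SubgroupsPermute A K) ∧
  (∀ H : Subgroup G, H ≤ A → SubgroupsPermute B H)

/-! ### Mutually permutable pairs and products. -/

namespace MutuallyPermutable

variable {G G' : Type*} [Group G] [Group G'] {A B : Subgroup G}

theorem symm (h : MutuallyPermutable A B) : MutuallyPermutable B A := ⟨h.2, h.1⟩

theorem permute (h : MutuallyPermutable A B) : SubgroupsPermute A B := h.1 B le_rfl

theorem inf (h : MutuallyPermutable A B) (U : Subgroup G) :
    MutuallyPermutable (A ⊓ U) (B ⊓ U) := by
  constructor
  · intro K hK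
    exact ((h.1 K (hK.trans inf_le_left)).symm.inf_right (hK.trans inf_le_right)).symm
  · intro H hH
    exact ((h.2 H (hH.trans inf_le_left)).symm.inf_right (hH.trans inf_le_right)).symm

theorem map (h : MutuallyPermutable A B) (f : G →* G') :
    MutuallyPermutable (A.map f) (B.map f) := by
  have key : ∀ (C : Subgroup G) (L : Subgroup G'), L ≤ C.map f → (C ⊓ L.comap f).map f = L := by
    intro C L hL
    apply le_antisymm
    · rintro _ ⟨x, ⟨_, hx⟩, rfl⟩
      exact hx
    · intro y hy
      obtain ⟨x, hx, rfl⟩ := hL hy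
      exact ⟨x, ⟨hx, hy⟩, rfl⟩
  constructor
  · intro L hL
    rw [← key B L hL]
    exact (h.1 _ inf_le_left).map f
  · intro L hL
    rw [← key A L hL]
    exact (h.2 _ inf_le_left).map f

/-- `A ⊓ B` permutes with every subgroup of `B`. -/
theorem inf_permute (h : MutuallyPermutable A B) {L : Subgroup G} (hL : L ≤ B) :
    SubgroupsPermute (A ⊓ B) L :=
  ((h.1 L hL).symm.inf_right hL).symm

end MutuallyPermutable

namespace IsMutuallyPermutableProduct

variable {G G' : Type*} [Group G] [Group G'] {A B : Subgroup G}

theorem mutuallyPermutable (h : IsMutuallyPermutableProduct A B) : MutuallyPermutable A B := h.2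

theorem exists_mul_eq (h : IsMutuallyPermutableProduct A B) (x : G) :
    ∃ a ∈ A, ∃ b ∈ B, a * b = x := by
  have : x ∈ (A : Set G) * (B : Set G) := by rw [h.1]; trivial
  exact Set.mem_mul.1 this

theorem sup_eq_top (h : IsMutuallyPermutableProduct A B) : A ⊔ B = ⊤ := by
  rw [eq_top_iff]
  intro x _
  obtain ⟨a, ha, b, hb, rfl⟩ := h.exists_mul_eq x
  exact Subgroup.mul_mem_sup ha hb

theorem symm (h : IsMutuallyPermutableProduct A B) : IsMutuallyPermutableProduct B A := by
  refine ⟨?_, h.2.2, h.2.1⟩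
  rw [← h.1]
  exact h.2.2 A le_rfl

theorem map (h : IsMutuallyPermutableProduct A B) (f : G →* G') (hf : Function.Surjective f) :
    IsMutuallyPermutableProduct (A.map f) (B.map f) := by
  refine ⟨?_, h.mutuallyPermutable.map f⟩
  rw [Subgroup.coe_map, Subgroup.coe_map, ← Set.image_mul, h.1, Set.image_univ, hf.range_eq]

theorem card_dvd [Finite G] (h : IsMutuallyPermutableProduct A B) :
    Nat.card G ∣ Nat.card A * Nat.card B := by
  have := h.mutuallyPermutable.permute.card_sup_dvd
  rwa [h.sup_eq_top, Subgroup.card_top] at this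

/-- A subgroup that is normalised by both factors is normal. -/
theorem normal_of_conj_mem (h : IsMutuallyPermutableProduct A B) {M : Subgroup G}
    (hA : ∀ a ∈ A, ∀ x ∈ M, a * x * a⁻¹ ∈ M) (hB : ∀ b ∈ B, ∀ x ∈ M, b * x * b⁻¹ ∈ M) :
    M.Normal := by
  constructor
  intro x hx g
  obtain ⟨a, ha, b, hb, rfl⟩ := h.exists_mul_eq g
  have := hA a ha _ (hB b hb x hx)
  simpa [mul_assoc] using this

end IsMutuallyPermutableProduct

namespace MutuallyPermutable

variable {G : Type*} [Group G] {A B N : Subgroup G}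

/-- By Dedekind's law H(N ∩ B) = HB ∩ N, and B normalises both HB and N. This is the main source of
invariance under a factor. -/
theorem conj_mem_inf_sup [N.Normal] {H : Subgroup G} (h : SubgroupsPermute H B) (hH : H ≤ N)
    {b x : G} (hb : b ∈ B) (hx : x ∈ H ⊔ (N ⊓ B)) : b * x * b⁻¹ ∈ H ⊔ (N ⊓ B) := by
  rw [inf_comm, ← h.sup_inf hH] at hx ⊢
  have hb' : b ∈ H ⊔ B := Subgroup.mem_sup_right hb
  exact ⟨(H ⊔ B).mul_mem ((H ⊔ B).mul_mem hb' hx.1) ((H ⊔ B).inv_mem hb'), Subgroup.Normal.conj_mem inferInstance x hx.2 b⟩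

end MutuallyPermutable

theorem IsMutuallyPermutableProduct.normal_inf_sup_inf {G : Type*} [Group G] {A B : Subgroup G}
    (h : IsMutuallyPermutableProduct A B) (N : Subgroup G) [N.Normal] :
    ((N ⊓ A) ⊔ (N ⊓ B)).Normal := by
  apply h.normal_of_conj_mem
  · intro a ha x hx
    rw [sup_comm] at hx ⊢
    exact MutuallyPermutable.conj_mem_inf_sup (h.2.1 _ inf_le_right).symm inf_le_left ha hx
  · intro b hb x hx
    exact MutuallyPermutable.conj_mem_inf_sup (h.2.2 _ inf_le_right).symm inf_le_left hb hx

theorem Subgroup.normalizer_conj_mem {G : Type*} [Group G] {H : Subgroup G} {g : G}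
    (hg : g ∈ Subgroup.normalizer (H : Set G)) {x : G} (hx : x ∈ H) : g * x * g⁻¹ ∈ H :=
  (Subgroup.mem_normalizer_iff.1 hg x).1 hx

theorem Subgroup.mem_normalizer_of_conj_mem {G : Type*} [Group G] [Finite G] {H : Subgroup G} {g : G}
    (h : ∀ x ∈ H, g * x * g⁻¹ ∈ H) : g ∈ Subgroup.normalizer (H : Set G) := by
  have hle : H.map (MulAut.conj g).toMonoidHom ≤ H := by
    rintro _ ⟨x, hx, rfl⟩
    exact h x hx
  have heq : H.map (MulAut.conj g).toMonoidHom = H := by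
    apply Subgroup.eq_of_le_of_card_ge hle
    rw [Subgroup.card_map_of_injective (MulAut.conj g).injective]
  rw [Subgroup.mem_normalizer_iff]
  intro x
  refine ⟨h x, fun hx => ?_⟩
  have hx' : g * x * g⁻¹ ∈ H.map (MulAut.conj g).toMonoidHom := by rw [heq]; exact hx
  obtain ⟨y, hy, e⟩ := hx'
  have : y = x := by
    have e' : g * y * g⁻¹ = g * x * g⁻¹ := e
    simpa using e'
  exact this ▸ hy

/-! ### Solubility of a core-free group extended by a permuting subgroup of prime order. -/

section CoreFree

variable {Γ : Type*} [Group Γ] [Finite Γ] {U : Subgroup Γ} {b : Γ} {r : ℕ}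

theorem relIndex_zpowers_eq_prime {G : Type*} [Group G] {K : Subgroup G} {c : G} {r : ℕ}
    (hr : r.Prime) (hc : c ^ r ∈ K) (hcK : c ∉ K) : K.relIndex (Subgroup.zpowers c) = r := by
  let Z := Subgroup.zpowers c
  let cz : Z := ⟨c, Subgroup.mem_zpowers c⟩
  let y : Z ⧸ K.subgroupOf Z := QuotientGroup.mk cz
  have hy : orderOf y = r := by
    have := Fact.mk hr
    apply orderOf_eq_prime
    · change ((cz ^ r : Z) : Z ⧸ K.subgroupOf Z) = 1
      rw [QuotientGroup.eq_one_iff, Subgroup.mem_subgroupOf]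
      exact hc
    · intro h
      rw [QuotientGroup.eq_one_iff, Subgroup.mem_subgroupOf] at h
      exact hcK h
  rw [Subgroup.relIndex, Subgroup.index, ← hy, ← Nat.card_zpowers]
  have : Subgroup.zpowers y = ⊤ := by
    rw [eq_top_iff]
    rintro x -
    induction x using QuotientGroup.induction_on with
    | H x =>
      obtain ⟨x, n, rfl⟩ := x
      exact ⟨n, rfl⟩
  rw [this, Subgroup.card_top]

/-- Suppose h is an element of least order not normalising ⟨b⟩. With s the least prime factor of its
order, h^s normalises ⟨b⟩. In ⟨h⟩⟨b⟩ the Sylow r-subgroup ⟨b⟩ then has exactly s conjugates, so s ≡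
1 mod r, which is impossible since 1 < s < r. -/
theorem mem_normalizer_zpowers_of_core_free (hr : r.Prime) (hcard : ∀ s, s.Prime → s ∣ Nat.card U → s < r)
    (hb : b ^ r = 1) (hbU : b ∉ U)
    (hperm : ∀ H ≤ U, SubgroupsPermute H (Subgroup.zpowers b)) :
    ∀ n, ∀ h ∈ U, orderOf h = n → h ∈ Subgroup.normalizer (Subgroup.zpowers b : Set Γ) := by
  have := Fact.mk hr
  have hb1 : b ≠ 1 := fun h => hbU (h ▸ U.one_mem)
  have hob : orderOf b = r := orderOf_eq_prime hb hb1
  set N := Subgroup.normalizer (Subgroup.zpowers b : Set Γ) with hN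
  intro n
  induction n using Nat.strong_induction_on with
  | _ n ih =>
    intro h hU hn
    by_cases h1 : n = 1
    · rw [h1, orderOf_eq_one_iff] at hn
      rw [hn]; exact N.one_mem
    set s := n.minFac with hs
    have hsp : s.Prime := Nat.minFac_prime h1
    have hsn : s ∣ n := Nat.minFac_dvd n
    have hn0 : 0 < n := hn ▸ orderOf_pos h
    have hsr : s < r := by
      apply hcard s hsp
      refine hsn.trans ?_
      rw [← hn, ← Subgroup.orderOf_mk (H := U) h hU]
      exact orderOf_dvd_natCard _
    have hhs : h ^ s ∈ N := by
      refine ih (n / s) (Nat.div_lt_self hn0 hsp.one_lt) _ (U.pow_mem hU s) ?_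
      rw [orderOf_pow_of_dvd hsp.ne_zero (hn ▸ hsn), hn]
    by_contra hhN
    have hbN : Subgroup.zpowers b ≤ N := Subgroup.le_normalizer
    let W := Subgroup.zpowers h ⊔ Subgroup.zpowers b
    have hp : SubgroupsPermute (Subgroup.zpowers h) (Subgroup.zpowers b) :=
      hperm _ ((Subgroup.zpowers_le).2 hU)
    have hcoprime : ∀ m, m ∣ Nat.card U → Nat.Coprime m r := by
      intro m hm
      rw [Nat.coprime_comm, hr.coprime_iff_not_dvd]
      intro hd
      exact lt_irrefl _ (hcard r hr (hd.trans hm))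
    have hcardW : Nat.card W ∣ Nat.card U * r := by
      refine hp.card_sup_dvd.trans ?_
      rw [Nat.card_zpowers b, hob]
      exact mul_dvd_mul_right (Subgroup.card_dvd_of_le ((Subgroup.zpowers_le).2 hU)) _
    have hbW : Subgroup.zpowers b ≤ W := le_sup_right
    let Q : Subgroup W := (Subgroup.zpowers b).subgroupOf W
    have hQcard : Nat.card Q = r := by
      rw [Nat.card_congr (Subgroup.subgroupOfEquivOfLe hbW).toEquiv, Nat.card_zpowers, hob]
    have hQp : IsPGroup r Q := IsPGroup.of_card (n := 1) (by rw [hQcard, pow_one])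
    have hQind : ¬ r ∣ Q.index := by
      intro hd
      have h2 : r * r ∣ Nat.card W := by
        rw [← Q.card_mul_index, hQcard]
        exact mul_dvd_mul_left r hd
      have h3 : r ∣ Nat.card U := Nat.dvd_of_mul_dvd_mul_right hr.pos (h2.trans hcardW)
      exact lt_irrefl _ (hcard r hr h3)
    let P : Sylow r W := hQp.toSylow hQind
    have hPQ : (P : Subgroup W) = Q := rfl
    have hmod := card_sylow_modEq_one r W
    rw [P.card_eq_index_normalizer] at hmod
    have hnorm : Subgroup.normalizer ((P : Subgroup W) : Set W) = N.subgroupOf W := by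
      rw [hPQ]
      exact (Subgroup.subgroupOf_normalizer_eq hbW).symm
    have hidx : (Subgroup.normalizer ((P : Subgroup W) : Set W)).index = s := by
      rw [hnorm]
      have e1 : N.relIndex (Subgroup.zpowers h) = s := relIndex_zpowers_eq_prime hsp hhs hhN
      rw [← e1]
      change N.relIndex W = _
      -- Dedekind's law. Comparing the orders of ⟨h⟩⟨b⟩ and (N ∩ ⟨h⟩)⟨b⟩ then gives |W : N ∩ W| =
      -- |⟨h⟩ : N ∩ ⟨h⟩| = s.
      have e2 : N ⊓ W = (N ⊓ Subgroup.zpowers h) ⊔ Subgroup.zpowers b := by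
        rw [inf_comm, show W = _ from sup_comm _ _, hp.symm.sup_inf hbN, sup_comm, inf_comm]
      have hp2 : SubgroupsPermute (N ⊓ Subgroup.zpowers h) (Subgroup.zpowers b) :=
        hperm _ (inf_le_right.trans ((Subgroup.zpowers_le).2 hU))
      have hdisj : ∀ H ≤ U, (Subgroup.zpowers b).relIndex H = Nat.card H := by
        intro H hH
        rw [← Subgroup.relIndex_bot_left, ← Subgroup.inf_relIndex_right]
        congr 1
        rw [eq_bot_iff]
        intro x hx
        have hd1 : orderOf x ∣ Nat.card U := by
          rw [← Subgroup.orderOf_mk (H := U) x (hH hx.2)]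
          exact orderOf_dvd_natCard _
        have hd2 : orderOf x ∣ r := by
          rw [← hob]
          exact orderOf_dvd_of_mem_zpowers hx.1
        have := Nat.eq_one_of_dvd_coprimes (hcoprime _ dvd_rfl) hd1 hd2
        rw [orderOf_eq_one_iff] at this
        exact this
      have c1 := hp.card_sup
      have c2 := hp2.card_sup
      rw [hdisj _ ((Subgroup.zpowers_le).2 hU)] at c1
      rw [hdisj _ (inf_le_right.trans ((Subgroup.zpowers_le).2 hU)), ← e2] at c2
      have c3 : Nat.card (N ⊓ W : Subgroup Γ) * N.relIndex W = Nat.card W := by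
        rw [← Subgroup.inf_relIndex_right, ← Subgroup.relIndex_bot_left, ← Subgroup.relIndex_bot_left]
        exact Subgroup.relIndex_mul_relIndex _ _ _ bot_le inf_le_right
      have c4 : Nat.card (N ⊓ Subgroup.zpowers h : Subgroup Γ) * N.relIndex (Subgroup.zpowers h)
          = Nat.card (Subgroup.zpowers h) := by
        rw [← Subgroup.inf_relIndex_right, ← Subgroup.relIndex_bot_left, ← Subgroup.relIndex_bot_left]
        exact Subgroup.relIndex_mul_relIndex _ _ _ bot_le inf_le_right
      have c5 : Nat.card W = Nat.card (Subgroup.zpowers b) * Nat.card (Subgroup.zpowers h) := c1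
      rw [← c4, ← mul_assoc, ← c2] at c5
      rw [← c3] at c5
      exact Nat.eq_of_mul_eq_mul_left Nat.card_pos c5
    replace hmod : (Subgroup.normalizer ((P : Subgroup W) : Set W)).index ≡ 1 [MOD r] := hmod
    rw [hidx] at hmod
    have : s % r = 1 % r := hmod
    rw [Nat.mod_eq_of_lt hsr, Nat.mod_eq_of_lt hr.one_lt] at this
    exact hsp.one_lt.ne' this

/-- A finite group with a core-free proper subgroup `U`, complemented by a subgroup of prime order
that permutes with all subgroups of `U`, is soluble. -/
theorem isSolvable_of_core_free (hr : r.Prime) (hcore : U.normalCore = ⊥)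
    (hb : b ^ r = 1) (hbU : b ∉ U) (htop : U ⊔ Subgroup.zpowers b = ⊤)
    (hperm : ∀ H ≤ U, SubgroupsPermute H (Subgroup.zpowers b)) : Group.IsSolvable Γ := by
  have := Fact.mk hr
  have hidx : U.index = r := by
    have h1 := (hperm U le_rfl).symm.relIndex_sup
    rw [sup_comm, htop, Subgroup.relIndex_top_right] at h1
    rw [h1]
    exact relIndex_zpowers_eq_prime hr (hb ▸ U.one_mem) hbU
  -- The action on the r cosets of U is faithful, so |Γ| divides r! and |U| divides (r - 1)!. Hence
  -- all primes dividing |U| are smaller than r.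
  have hcardΓ : Nat.card Γ ∣ r.factorial := by
    have h1 : U.normalCore.index ∣ U.index.factorial := by
      rw [Subgroup.normalCore_eq_ker, Subgroup.index_ker, Subgroup.index_eq_card, ← Nat.card_perm]
      exact Subgroup.card_subgroup_dvd_card _
    rwa [hcore, Subgroup.index_bot, hidx] at h1
  have hcard : ∀ s, s.Prime → s ∣ Nat.card U → s < r := by
    intro s hs hd
    have h1 : Nat.card U ∣ (r - 1).factorial := by
      rw [← U.card_mul_index, hidx, ← Nat.mul_factorial_pred hr.ne_zero, mul_comm] at hcardΓ
      exact Nat.dvd_of_mul_dvd_mul_left hr.pos hcardΓ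
    have h2 := (hs.dvd_factorial).1 (hd.trans h1)
    have := hr.pos
    omega
  set Z := Subgroup.zpowers b
  have hUN : U ≤ Subgroup.normalizer (Z : Set Γ) := fun h hh =>
    mem_normalizer_zpowers_of_core_free hr hcard hb hbU hperm _ h hh rfl
  have hZ : Z.Normal := by
    rw [← Subgroup.normalizer_eq_top_iff, eq_top_iff, ← htop]
    exact sup_le hUN Subgroup.le_normalizer
  -- The centraliser of Z in U is normalised by U and centralised by Z, so it is normal in Γ = UZ
  -- and lies in the trivial core.
  have hcent : U ⊓ Subgroup.centralizer (Z : Set Γ) = ⊥ := by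
    rw [eq_bot_iff, ← hcore]
    have : (U ⊓ Subgroup.centralizer (Z : Set Γ)).Normal := by
      constructor
      intro x hx g
      have hg : g ∈ U ⊔ Z := by rw [htop]; trivial
      obtain ⟨u, hu, z, hz, rfl⟩ := (hperm U le_rfl).mem_sup hg
      have hzx : z * x * z⁻¹ = x := by
        rw [(Subgroup.mem_centralizer_iff.1 hx.2) z hz]; group
      have : u * z * x * (u * z)⁻¹ = u * x * u⁻¹ := by
        calc u * z * x * (u * z)⁻¹ = u * (z * x * z⁻¹) * u⁻¹ := by group
          _ = _ := by rw [hzx]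
      rw [this]
      exact ⟨U.mul_mem (U.mul_mem hu hx.1) (U.inv_mem hu),
        Subgroup.Normal.conj_mem inferInstance x hx.2 u⟩
    exact Subgroup.normal_le_normalCore.2 inf_le_left
  -- U acts faithfully on the cyclic group Z by power maps, and power maps commute.
  have hcomm : ∀ u ∈ U, ∀ v ∈ U, u * v = v * u := by
    intro u hu v hv
    have h1 : ∀ w : Γ, ∃ n : ℤ, w * b * w⁻¹ = b ^ n := by
      intro w
      obtain ⟨n, hn⟩ := hZ.conj_mem b (Subgroup.mem_zpowers b) w
      exact ⟨n, hn.symm⟩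
    obtain ⟨n, hn⟩ := h1 u
    obtain ⟨m, hm⟩ := h1 v
    have key : ∀ (x y : Γ) (i j : ℤ), x * b * x⁻¹ = b ^ i → y * b * y⁻¹ = b ^ j →
        (x * y) * b * (x * y)⁻¹ = b ^ (i * j) := by
      intro x y i j hi hj
      calc (x * y) * b * (x * y)⁻¹ = x * (y * b * y⁻¹) * x⁻¹ := by group
        _ = (x * b * x⁻¹) ^ j := by rw [hj, conj_zpow]
        _ = _ := by rw [hi, zpow_mul]
    have h2 : (v * u)⁻¹ * (u * v) ∈ U ⊓ Subgroup.centralizer (Z : Set Γ) := by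
      refine ⟨U.mul_mem (U.inv_mem (U.mul_mem hv hu)) (U.mul_mem hu hv), ?_⟩
      refine Subgroup.mem_centralizer_iff.2 ?_
      have h3 : (u * v) * b * (u * v)⁻¹ = (v * u) * b * (v * u)⁻¹ := by
        rw [key u v n m hn hm, key v u m n hm hn, mul_comm]
      have h4 : Commute ((v * u)⁻¹ * (u * v)) b := by
        have : (v * u)⁻¹ * (u * v) * b * ((v * u)⁻¹ * (u * v))⁻¹ = b := by
          calc (v * u)⁻¹ * (u * v) * b * ((v * u)⁻¹ * (u * v))⁻¹
              = (v * u)⁻¹ * ((u * v) * b * (u * v)⁻¹) * (v * u) := by group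
            _ = b := by rw [h3]; group
        exact mul_inv_eq_iff_eq_mul.1 this
      rintro z ⟨k, rfl⟩
      exact (h4.zpow_right k).symm
    rw [hcent, Subgroup.mem_bot, inv_mul_eq_one] at h2
    exact h2.symm
  have hUs : Group.IsSolvable U := Group.isSolvable_of_comm fun x y => Subtype.ext (hcomm x x.2 y y.2)
  have hZs : Group.IsSolvable Z := Group.isSolvable_of_comm (by
    rintro ⟨_, i, rfl⟩ ⟨_, j, rfl⟩
    exact Subtype.ext (zpow_mul_comm b i j))
  have hQs : Group.IsSolvable (Γ ⧸ Z) := by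
    refine Group.isSolvable_of_surjective (f := (QuotientGroup.mk' Z).comp U.subtype) ?_
    intro y
    induction y using QuotientGroup.induction_on with
    | H g =>
      have hg : g ∈ U ⊔ Z := by rw [htop]; trivial
      obtain ⟨u, hu, z, hz, rfl⟩ := (hperm U le_rfl).mem_sup hg
      refine ⟨⟨u, hu⟩, ?_⟩
      change (u : Γ ⧸ Z) = ((u * z : Γ) : Γ ⧸ Z)
      rw [QuotientGroup.eq]; simpa using hz
  exact (Group.isSolvable_iff_subgroup_quotient Z).2 ⟨hZs, hQs⟩

end CoreFree

/-! ### Perfect subgroups of mutually permutable products. -/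

section Perfect

variable {G : Type*} [Group G]

theorem Subgroup.eq_bot_of_perfect [Group.IsSolvable G] {P : Subgroup G} (hP : ⁅P, P⁆ = P) : P = ⊥ := by
  by_contra h
  exact (Group.IsSolvable.commutator_lt_of_ne_bot h).ne hP

theorem Subgroup.isSolvable_of_le {H K : Subgroup G} (h : H ≤ K) (hK : Group.IsSolvable K) :
    Group.IsSolvable H :=
  Group.isSolvable_of_isSolvable_injective (Subgroup.inclusion_injective h)

theorem Subgroup.commutator_lt_self {L : Subgroup G} (hL : Group.IsSolvable L) (h : L ≠ ⊥) :
    ⁅L, L⁆ < L := by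
  rw [← Subgroup.nontrivial_iff_ne_bot] at h
  have h1 := Group.IsSolvable.commutator_lt_top_of_nontrivial L
  have h2 := (Subgroup.map_subtype_lt_map_subtype (G' := L)).2 h1
  rwa [_root_.commutator, Subgroup.map_commutator, ← MonoidHom.range_eq_map,
    Subgroup.range_subtype] at h2

theorem Subgroup.eq_bot_of_perfect_le {L P : Subgroup G} (hL : Group.IsSolvable L) (hPL : P ≤ L)
    (hP : ⁅P, P⁆ = P) : P = ⊥ := by
  by_contra h
  exact (Subgroup.commutator_lt_self (Subgroup.isSolvable_of_le hPL hL) h).ne hP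

theorem Subgroup.exists_perfect_ne_bot [Finite G] {L : Subgroup G} (hL : ¬ Group.IsSolvable L) :
    ∃ P ≤ L, ⁅P, P⁆ = P ∧ P ≠ ⊥ := by
  rw [Group.isSolvable_iff_commutator_lt] at hL
  push Not at hL
  obtain ⟨P, hP, hlt⟩ := hL
  have hPP : ⁅P, P⁆ = P := by
    by_contra h
    exact hlt (lt_of_le_of_ne (Subgroup.commutator_le_self P) h)
  refine ⟨P.map L.subtype, Subgroup.map_subtype_le P, ?_, ?_⟩
  · rw [← Subgroup.map_commutator, hPP]
  · rwa [Ne, Subgroup.map_eq_bot_iff_of_injective _ L.subtype_injective]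

theorem Subgroup.exists_pow_notMem_pow_prime_mem [Finite G] {K : Subgroup G} {b : G} (hb : b ∉ K) :
    ∃ j r : ℕ, r.Prime ∧ b ^ j ∉ K ∧ (b ^ j) ^ r ∈ K := by
  classical
  have hex : ∃ n, 0 < n ∧ b ^ n ∈ K := ⟨orderOf b, orderOf_pos b, by rw [pow_orderOf_eq_one]; exact K.one_mem⟩
  set n := Nat.find hex with hn
  obtain ⟨hpos, hmem⟩ := Nat.find_spec hex
  rw [← hn] at hpos hmem
  have h1 : n ≠ 1 := fun h => hb (by rwa [h, pow_one] at hmem)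
  have hr := Nat.minFac_prime h1
  have hd := Nat.minFac_dvd n
  refine ⟨n / n.minFac, n.minFac, hr, ?_, ?_⟩
  · intro h
    exact Nat.find_min hex (Nat.div_lt_self hpos hr.one_lt) ⟨Nat.div_pos (Nat.le_of_dvd hpos hd) hr.pos, h⟩
  · rw [← pow_mul, Nat.div_mul_cancel hd]; exact hmem

theorem Subgroup.exists_maximal_normal [Finite G] {L : Subgroup G} (hL : Group.IsSolvable L) (h : L ≠ ⊥) :
    ∃ M < L, (∀ l ∈ L, ∀ x ∈ M, l * x * l⁻¹ ∈ M) ∧ ∀ K, M ≤ K → K ≤ L → K = M ∨ K = L := by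
  have hlt := Subgroup.commutator_lt_self hL h
  obtain ⟨M, hM⟩ := (Set.toFinite {K : Subgroup G | ⁅L, L⁆ ≤ K ∧ K < L}).exists_maximal
    ⟨⁅L, L⁆, le_rfl, hlt⟩
  refine ⟨M, hM.prop.2, ?_, ?_⟩
  · intro l hl x hx
    have := M.mul_mem (hM.prop.1 (Subgroup.commutator_mem_commutator hl (hM.prop.2.le hx))) hx
    rwa [commutatorElement_def, inv_mul_cancel_right] at this
  · intro K hMK hKL
    by_cases hK : K = L
    · exact Or.inr hK
    · exact Or.inl (le_antisymm (hM.le_of_ge ⟨hM.prop.1.trans hMK, lt_of_le_of_ne hKL hK⟩ hMK) hMK)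

/-- If `Γ = AJ`, every subgroup of `A` permutes with `J`, and `J₀` is normal in `J` with cyclic
quotient of prime order or trivial, then `AJ₀` contains all perfect subgroups. -/
theorem perfect_le_sup_of_step {Γ : Type*} [Group Γ] [Finite Γ] {A J J₀ P : Subgroup Γ} {b : Γ} {r : ℕ}
    (hr : r.Prime) (hnorm : J ≤ Subgroup.normalizer (J₀ : Set Γ)) (hJ : J = J₀ ⊔ Subgroup.zpowers b)
    (hb : b ^ r ∈ J₀) (htop : A ⊔ J = ⊤) (hperm : ∀ H ≤ A, SubgroupsPermute H J)
    (hP : ⁅P, P⁆ = P) : P ≤ A ⊔ J₀ := by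
  set X := A ⊔ J₀ with hX
  have hXb : X ⊔ Subgroup.zpowers b = ⊤ := by rw [hX, sup_assoc, ← hJ, htop]
  by_cases hbX : b ∈ X
  · rw [sup_of_le_left ((Subgroup.zpowers_le).2 hbX)] at hXb
    rw [hXb]; exact le_top
  -- Write a conjugating element as aj: J₀ is invariant under j ∈ J, and a ∈ A lies in X = AJ₀.
  have hJC : J₀ ≤ X.normalCore := by
    intro y hy g
    have hg : g ∈ A ⊔ J := by rw [htop]; trivial
    obtain ⟨a, ha, j, hj, rfl⟩ := (hperm A le_rfl).mem_sup hg
    have h1 : j * y * j⁻¹ ∈ X := Subgroup.mem_sup_right (Subgroup.normalizer_conj_mem (hnorm hj) hy)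
    have ha' : a ∈ X := Subgroup.mem_sup_left ha
    have : a * j * y * (a * j)⁻¹ = a * (j * y * j⁻¹) * a⁻¹ := by group
    rw [this]
    exact X.mul_mem (X.mul_mem ha' h1) (X.inv_mem ha')
  set C := X.normalCore with hC
  let f := QuotientGroup.mk' C
  have hker : f.ker = C := QuotientGroup.ker_mk' C
  have hCX : C ≤ X := Subgroup.normalCore_le X
  have hpull : ∀ g, f g ∈ X.map f → g ∈ X := by
    intro g hg
    have : g ∈ (X.map f).comap f := hg
    rwa [Subgroup.comap_map_eq, hker, sup_of_le_left hCX] at this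
  have hJbot : J₀.map f = ⊥ := by rw [Subgroup.map_eq_bot_iff, hker]; exact hJC
  have hXA : X.map f = A.map f := by
    rw [show X.map f = (A ⊔ J₀).map f from rfl, Subgroup.map_sup, hJbot, sup_bot_eq]
  have hJm : J.map f = Subgroup.zpowers (f b) := by
    rw [hJ, Subgroup.map_sup, hJbot, bot_sup_eq, MonoidHom.map_zpowers]
  -- Modulo C the subgroup J₀ vanishes: X becomes the image of A and is core-free, while J becomes
  -- ⟨b⟩ with b of order r. The quotient is therefore soluble and kills P.
  have hsol : Group.IsSolvable (Γ ⧸ C) := by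
    refine isSolvable_of_core_free (U := X.map f) (b := f b) hr ?_ ?_ ?_ ?_ ?_
    · rw [eq_bot_iff]
      intro y hy
      obtain ⟨x, rfl⟩ := QuotientGroup.mk'_surjective C y
      have : x ∈ C := by
        intro g
        refine hpull _ ?_
        rw [map_mul, map_mul, map_inv]
        exact hy (f g)
      rw [Subgroup.mem_bot]
      rwa [← hker] at this
    · rw [← map_pow]
      have : b ^ r ∈ f.ker := by rw [hker]; exact hJC hb
      exact this
    · exact fun h => hbX (hpull _ h)
    · rw [← MonoidHom.map_zpowers, ← Subgroup.map_sup, hXb,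
        Subgroup.map_top_of_surjective _ (QuotientGroup.mk'_surjective C)]
    · intro H hH
      rw [hXA] at hH
      rw [← hJm]
      have : (A ⊓ H.comap f).map f = H := by
        apply le_antisymm
        · rintro _ ⟨x, ⟨_, hx⟩, rfl⟩
          exact hx
        · intro y hy
          obtain ⟨x, hx, rfl⟩ := hH hy
          exact ⟨x, ⟨hx, hy⟩, rfl⟩
      rw [← this]
      exact (hperm _ inf_le_left).map f
  have hPm : P.map f = ⊥ := Subgroup.eq_bot_of_perfect (by rw [← Subgroup.map_commutator, hP])
  rw [Subgroup.map_eq_bot_iff, hker] at hPm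
  exact hPm.trans hCX

/-- The preceding step carried out inside the subgroup AJ instead of the whole group. -/
theorem perfect_le_sup_of_step_of_le [Finite G] {A J J₀ P : Subgroup G} {b : G} {r : ℕ}
    (hr : r.Prime) (hnorm : J ≤ Subgroup.normalizer (J₀ : Set G)) (hJ : J = J₀ ⊔ Subgroup.zpowers b)
    (hb : b ^ r ∈ J₀) (hperm : ∀ H ≤ A, SubgroupsPermute H J)
    (hP : ⁅P, P⁆ = P) (hPX : P ≤ A ⊔ J) : P ≤ A ⊔ J₀ := by
  set X := A ⊔ J with hX
  have hAX : A ≤ X := le_sup_left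
  have hJX : J ≤ X := le_sup_right
  have hJ₀J : J₀ ≤ J := by rw [hJ]; exact le_sup_left
  have hbJ : b ∈ J := by rw [hJ]; exact Subgroup.mem_sup_right (Subgroup.mem_zpowers b)
  have hZ : Subgroup.zpowers b ≤ J := (Subgroup.zpowers_le).2 hbJ
  have key : P.subgroupOf X ≤ A.subgroupOf X ⊔ J₀.subgroupOf X := by
    refine perfect_le_sup_of_step (J := J.subgroupOf X) (b := ⟨b, hJX hbJ⟩) hr ?_ ?_ ?_ ?_ ?_ ?_
    · rintro ⟨x, hxX⟩ hx
      refine Subgroup.mem_normalizer_of_conj_mem ?_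
      rintro ⟨y, hyX⟩ hy
      exact Subgroup.mem_subgroupOf.2 (Subgroup.normalizer_conj_mem (hnorm (Subgroup.mem_subgroupOf.1 hx))
        (Subgroup.mem_subgroupOf.1 hy))
    · have : Subgroup.zpowers (⟨b, hJX hbJ⟩ : X) = (Subgroup.zpowers b).subgroupOf X := by
        apply Subgroup.map_injective X.subtype_injective
        rw [MonoidHom.map_zpowers, Subgroup.map_subgroupOf_eq_of_le (hZ.trans hJX)]
        rfl
      rw [this, ← Subgroup.subgroupOf_sup (hJ₀J.trans hJX) (hZ.trans hJX), ← hJ]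
    · exact Subgroup.mem_subgroupOf.2 hb
    · rw [← Subgroup.subgroupOf_sup hAX hJX, ← hX, Subgroup.subgroupOf_self]
    · intro H hH
      have hHA : H.map X.subtype ≤ A := by
        rintro _ ⟨x, hx, rfl⟩
        exact Subgroup.mem_subgroupOf.1 (hH hx)
      have := (hperm _ hHA).subgroupOf (hHA.trans hAX) hJX
      rwa [show (H.map X.subtype).subgroupOf X = H from
        Subgroup.comap_map_eq_self_of_injective X.subtype_injective H] at this
    · apply Subgroup.map_injective X.subtype_injective
      rw [Subgroup.map_commutator, Subgroup.map_subgroupOf_eq_of_le hPX, hP]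
  rw [← Subgroup.subgroupOf_sup hAX (hJ₀J.trans hJX)] at key
  intro x hx
  exact Subgroup.mem_subgroupOf.1 (key (Subgroup.mem_subgroupOf.2 hx : (⟨x, hPX hx⟩ : X) ∈ _))

/-- For mutually permutable `A` and `B` and a soluble subgroup `L` of `B`, all perfect subgroups of
`AL` lie in `A`. -/
theorem MutuallyPermutable.perfect_le [Finite G] {A B : Subgroup G} (h : MutuallyPermutable A B)
    {P : Subgroup G} (hP : ⁅P, P⁆ = P) :
    ∀ n, ∀ L ≤ B, Nat.card L = n → Group.IsSolvable L → P ≤ A ⊔ L → P ≤ A := by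
  intro n
  induction n using Nat.strong_induction_on with
  | _ n ih =>
    intro L hLB hn hLs hPL
    by_cases hbot : L = ⊥
    · rwa [hbot, sup_bot_eq] at hPL
    obtain ⟨M, hML, hMn, hMm⟩ := Subgroup.exists_maximal_normal hLs hbot
    have hMB := hML.le.trans hLB
    refine ih (Nat.card M) ?_ M hMB rfl (Subgroup.isSolvable_of_le hML.le hLs) ?_
    · rw [← hn]
      by_contra hc
      exact hML.ne (Subgroup.eq_of_le_of_card_ge hML.le (not_lt.1 hc))
    obtain ⟨c, hcL, hcM⟩ := SetLike.exists_of_lt hML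
    obtain ⟨j, r, hr, hbM, hbr⟩ := Subgroup.exists_pow_notMem_pow_prime_mem hcM
    set b := c ^ j
    have hbL : b ∈ L := L.pow_mem hcL j
    have hMb : M ⊔ Subgroup.zpowers b = L := by
      rcases hMm (M ⊔ Subgroup.zpowers b) le_sup_left (sup_le hML.le ((Subgroup.zpowers_le).2 hbL)) with e | e
      · exact absurd (e ▸ Subgroup.mem_sup_right (Subgroup.mem_zpowers b)) hbM
      · exact e
    set D := A ⊓ B with hD
    set J := D ⊔ L with hJ
    set J₀ := D ⊔ M with hJ₀
    have hJ₀B : J₀ ≤ B := sup_le inf_le_right hMB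
    have hDL : SubgroupsPermute D L := h.inf_permute hLB
    -- The conjugate K of J₀ by l contains M and permutes with D. As M is maximal in L, DK ∩ L is M
    -- or L. In the first case DK = D(DK ∩ L) = J₀ contains K.
    have hconj : ∀ l ∈ L, ∀ x ∈ J₀, l⁻¹ * x * l ∈ J₀ := by
      intro l hl
      set K := J₀.map (MulAut.conj l⁻¹).toMonoidHom with hK
      have hKmem : ∀ x ∈ J₀, l⁻¹ * x * l ∈ K := fun x hx => ⟨x, hx, by simp⟩
      have hKJ : K ≤ J := by
        rintro _ ⟨x, hx, rfl⟩
        have hl' : l ∈ J := Subgroup.mem_sup_right hl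
        have hx' : x ∈ J := sup_le_sup_left hML.le D hx
        simpa using J.mul_mem (J.mul_mem (J.inv_mem hl') hx') hl'
      have hMK : M ≤ K := by
        intro m hm
        have := hKmem _ (Subgroup.mem_sup_right (hMn l hl m hm))
        simpa [mul_assoc] using this
      have hKB : K ≤ B := hKJ.trans (sup_le inf_le_right hLB)
      have hDK : SubgroupsPermute D K := h.inf_permute hKB
      rcases hMm ((D ⊔ K) ⊓ L) (le_inf (hMK.trans le_sup_right) hML.le) inf_le_right with e | e
      · have : D ⊔ K ≤ J₀ := by
          calc D ⊔ K ≤ (D ⊔ L) ⊓ (D ⊔ K) := le_inf (sup_le le_sup_left hKJ) le_rfl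
            _ ≤ D ⊔ (L ⊓ (D ⊔ K)) := hDL.sup_inf_le le_sup_left
            _ = J₀ := by rw [inf_comm, e]
        intro x hx
        exact this (Subgroup.mem_sup_right (hKmem x hx))
      · have hl' : l ∈ D ⊔ K := (show l ∈ (D ⊔ K) ⊓ L by rw [e]; exact hl).1
        obtain ⟨d, hd, k, ⟨x, hx, rfl⟩, hdk⟩ := hDK.mem_sup hl'
        -- In the second case l = d · l⁻¹xl with d ∈ D and x ∈ J₀. Cancelling gives l = xd, so l
        -- itself lies in J₀.
        have hlJ : l ∈ J₀ := by
          have e1 : d * (l⁻¹ * x * l) = l := by simpa using hdk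
          have e2 : l = x * d := by
            have : d * (l⁻¹ * x) = 1 := by
              rw [← mul_left_inj l]; simpa [mul_assoc] using e1
            have h3 := eq_inv_of_mul_eq_one_left this
            rw [h3]; group
          rw [e2]
          exact J₀.mul_mem hx (Subgroup.mem_sup_left hd)
        intro y hy
        exact J₀.mul_mem (J₀.mul_mem (J₀.inv_mem hlJ) hy) hlJ
    have hnorm : J ≤ Subgroup.normalizer (J₀ : Set G) := by
      refine sup_le (le_sup_left.trans Subgroup.le_normalizer) ?_
      intro l hl
      refine Subgroup.mem_normalizer_of_conj_mem ?_
      intro x hx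
      simpa using hconj l⁻¹ (L.inv_mem hl) x hx
    have hDA : D ≤ A := inf_le_left
    have hAJ : A ⊔ J = A ⊔ L := by rw [hJ, ← sup_assoc, sup_of_le_left hDA]
    have hAJ₀ : A ⊔ J₀ = A ⊔ M := by rw [hJ₀, ← sup_assoc, sup_of_le_left hDA]
    rw [← hAJ₀]
    refine perfect_le_sup_of_step_of_le (J := J) (b := b) hr hnorm ?_ (Subgroup.mem_sup_right hbr) ?_ hP
      (by rwa [hAJ])
    · rw [hJ₀, sup_assoc, hMb]
    · intro H hH
      -- J = B ∩ AL by Dedekind's law; H permutes with B and lies in AL, so it permutes with J.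
      have h1 : SubgroupsPermute H (B ⊓ (A ⊔ L)) :=
        (h.2 H hH).symm.inf_right (hH.trans le_sup_left)
      have h2 : B ⊓ (A ⊔ L) = J := by
        rw [inf_comm, sup_comm, (h.1 L hLB).symm.sup_inf hLB, sup_comm]
      rwa [h2] at h1

theorem MutuallyPermutable.isSolvable_sup [Finite G] {A B : Subgroup G} (h : MutuallyPermutable A B)
    (hA : Group.IsSolvable A) (hB : Group.IsSolvable B) : Group.IsSolvable (A ⊔ B : Subgroup G) := by
  by_contra hns
  obtain ⟨P, hP, hPP, hPb⟩ := Subgroup.exists_perfect_ne_bot hns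
  exact hPb (Subgroup.eq_bot_of_perfect_le hA (h.perfect_le hPP _ B le_rfl rfl hB hP) hPP)

/-- The subgroup generated by all perfect subgroups of `A`. -/
def perfectResidual (A : Subgroup G) : Subgroup G := sSup {P | P ≤ A ∧ ⁅P, P⁆ = P}

theorem perfectResidual_le (A : Subgroup G) : perfectResidual A ≤ A := sSup_le fun _ h => h.1

theorem le_perfectResidual {A P : Subgroup G} (hPA : P ≤ A) (hP : ⁅P, P⁆ = P) :
    P ≤ perfectResidual A := le_sSup ⟨hPA, hP⟩

theorem conj_mem_perfectResidual {A : Subgroup G} {g : G}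
    (h : ∀ P ≤ A, ⁅P, P⁆ = P → P.map (MulAut.conj g).toMonoidHom ≤ A) {x : G}
    (hx : x ∈ perfectResidual A) : g * x * g⁻¹ ∈ perfectResidual A := by
  have : perfectResidual A ≤ (perfectResidual A).comap (MulAut.conj g).toMonoidHom := by
    refine sSup_le fun P hP => ?_
    rw [← Subgroup.map_le_iff_le_comap]
    refine le_perfectResidual (h P hP.1 hP.2) ?_
    rw [← Subgroup.map_commutator, hP.2]
  exact this hx

/-- For b ∈ B and P ≤ A perfect, the conjugate of P by b is a perfect subgroup of A⟨b⟩ with ⟨b⟩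
soluble, hence lies in A. -/
theorem IsMutuallyPermutableProduct.perfectResidual_normal [Finite G] {A B : Subgroup G}
    (h : IsMutuallyPermutableProduct A B) : (perfectResidual A).Normal := by
  apply h.normal_of_conj_mem
  · intro a ha x hx
    refine conj_mem_perfectResidual ?_ hx
    rintro P hP - _ ⟨y, hy, rfl⟩
    exact A.mul_mem (A.mul_mem ha (hP hy)) (A.inv_mem ha)
  · intro b hb x hx
    refine conj_mem_perfectResidual ?_ hx
    intro P hP hPP
    have hs : Group.IsSolvable (Subgroup.zpowers b) := Group.isSolvable_of_comm (by
      rintro ⟨_, i, rfl⟩ ⟨_, j, rfl⟩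
      exact Subtype.ext (zpow_mul_comm b i j))
    refine h.mutuallyPermutable.perfect_le ?_ _ (Subgroup.zpowers b) ((Subgroup.zpowers_le).2 hb) rfl hs ?_
    · rw [← Subgroup.map_commutator, hPP]
    · rintro _ ⟨y, hy, rfl⟩
      have hb' : b ∈ A ⊔ Subgroup.zpowers b := Subgroup.mem_sup_right (Subgroup.mem_zpowers b)
      exact Subgroup.mul_mem _ (Subgroup.mul_mem _ hb' (Subgroup.mem_sup_left (hP hy)))
        (Subgroup.inv_mem _ hb')

end Perfect

/-- `N` is a minimal normal subgroup of `G`. -/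
structure IsMinimalNormal {G : Type*} [Group G] (N : Subgroup G) : Prop where
  normal : N.Normal
  ne_bot : N ≠ ⊥
  eq_of_le : ∀ M : Subgroup G, M.Normal → M ≤ N → M = ⊥ ∨ M = N

/-! ### Minimal normal subgroups and their intersections with the factors. -/

section MinimalNormal

variable {G : Type*} [Group G]

theorem exists_isMinimalNormal [Finite G] [Nontrivial G] : ∃ N : Subgroup G, IsMinimalNormal N := by
  obtain ⟨N, hN⟩ := (Set.toFinite {K : Subgroup G | K.Normal ∧ K ≠ ⊥}).exists_minimal
    ⟨⊤, inferInstance, top_ne_bot⟩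
  refine ⟨N, hN.prop.1, hN.prop.2, fun M hM hMN => ?_⟩
  by_cases h : M = ⊥
  · exact Or.inl h
  · exact Or.inr (le_antisymm hMN (hN.le_of_le ⟨hM, h⟩ hMN))

namespace IsMinimalNormal

variable {N : Subgroup G}

theorem le_or_inf_eq_bot (hN : IsMinimalNormal N) {M : Subgroup G} (hM : M.Normal) :
    N ≤ M ∨ N ⊓ M = ⊥ := by
  have := hN.normal
  rcases hN.eq_of_le (N ⊓ M) inferInstance inf_le_left with h | h
  · exact Or.inr h
  · exact Or.inl (inf_eq_left.1 h)

theorem commute_of_inf_eq_bot (hN : IsMinimalNormal N) {M : Subgroup G} (hM : M.Normal)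
    (h : N ⊓ M = ⊥) {x y : G} (hx : x ∈ M) (hy : y ∈ N) : x * y = y * x :=
  Subgroup.commute_of_normal_of_disjoint M N hM hN.normal (disjoint_iff.2 (inf_comm N M ▸ h)) x y hx hy

/-- A soluble minimal normal subgroup is an elementary abelian `p`-group. -/
theorem elementary_of_isSolvable [Finite G] (hN : IsMinimalNormal N) (hs : Group.IsSolvable N)
    {p : ℕ} (hp : p.Prime) (hpN : p ∣ Nat.card N) :
    (∀ x ∈ N, ∀ y ∈ N, x * y = y * x) ∧ ∀ x ∈ N, x ^ p = 1 := by
  have := hN.normal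
  have hcomm : ∀ x ∈ N, ∀ y ∈ N, x * y = y * x := by
    have hlt := Subgroup.commutator_lt_self hs hN.ne_bot
    rcases hN.eq_of_le ⁅N, N⁆ inferInstance hlt.le with h | h
    · intro x hx y hy
      have h1 := Subgroup.commutator_mem_commutator hx hy
      rw [h, Subgroup.mem_bot, commutatorElement_def] at h1
      rwa [mul_inv_eq_one, mul_inv_eq_iff_eq_mul] at h1
    · exact absurd h hlt.ne
  refine ⟨hcomm, ?_⟩
  let S : Subgroup G :=
    { carrier := {x | x ∈ N ∧ x ^ p = 1}
      one_mem' := ⟨N.one_mem, one_pow p⟩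
      mul_mem' := fun {x y} hx hy => ⟨N.mul_mem hx.1 hy.1, by
        rw [(show Commute x y from hcomm x hx.1 y hy.1).mul_pow, hx.2, hy.2, one_mul]⟩
      inv_mem' := fun {x} hx => ⟨N.inv_mem hx.1, by rw [inv_pow, hx.2, inv_one]⟩ }
  have hS : S.Normal := ⟨fun x hx g => ⟨hN.normal.conj_mem x hx.1 g, by
    rw [conj_pow, hx.2, mul_one, mul_inv_cancel]⟩⟩
  have hSN : S ≤ N := fun x hx => hx.1
  rcases hN.eq_of_le S hS hSN with h | h
  · have := Fact.mk hp
    obtain ⟨x, hx⟩ := exists_prime_orderOf_dvd_card' p hpN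
    have hxS : (x : G) ∈ S := ⟨x.2, by rw [← SubmonoidClass.coe_pow, ← hx, pow_orderOf_eq_one]; rfl⟩
    rw [h, Subgroup.mem_bot, OneMemClass.coe_eq_one] at hxS
    rw [hxS, orderOf_one] at hx
    exact absurd hx.symm hp.ne_one
  · intro x hx
    exact (h ▸ hx : x ∈ S).2

end IsMinimalNormal

/-- With W = ⟨c⟩B, Dedekind's law gives W = (N ∩ W)B. As N ∩ B = 1, the order of N ∩ W is |W : B| =
|⟨c⟩ : ⟨c⟩ ∩ B| = r. -/
theorem card_inf_sup_zpowers [Finite G] {B N : Subgroup G} [N.Normal] {c : G} {r : ℕ} (hr : r.Prime)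
    (hperm : SubgroupsPermute (Subgroup.zpowers c) B) (hc : c ^ r ∈ B) (hcB : c ∉ B)
    (hNB : N ⊓ B = ⊥) (hcN : c ∈ N ⊔ B) :
    Nat.card (N ⊓ (Subgroup.zpowers c ⊔ B) : Subgroup G) = r := by
  set W := Subgroup.zpowers c ⊔ B with hW
  have hBN : SubgroupsPermute B N := (SubgroupsPermute.of_normal_left N B).symm
  have hBW : B ≤ W := le_sup_right
  have h1 : SubgroupsPermute B (N ⊓ W) := hBN.inf_right hBW
  have h2 : (N ⊓ W) ⊔ B = W := by
    rw [sup_comm, ← hBN.sup_inf hBW, inf_eq_right, hW, sup_comm B N]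
    exact sup_le ((Subgroup.zpowers_le).2 hcN) le_sup_right
  have h3 := h1.symm.relIndex_sup
  rw [h2, hW, hperm.relIndex_sup, relIndex_zpowers_eq_prime hr hc hcB] at h3
  rw [h3, ← Subgroup.inf_relIndex_right]
  have h4 : B ⊓ (N ⊓ (Subgroup.zpowers c ⊔ B)) = ⊥ := by
    rw [eq_bot_iff, ← hNB]
    exact fun x hx => ⟨hx.2.1, hx.1⟩
  rw [h4, Subgroup.relIndex_bot_left]

namespace IsMutuallyPermutableProduct

variable {A B N : Subgroup G}

/-- Choose c ∈ A outside B with c^r ∈ B and c = md, where m ∈ N and d ∈ B. Then N ∩ ⟨c⟩B and N ∩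
⟨d⟩A both have order r and contain m ≠ 1, so both equal ⟨m⟩. The first is normalised by B and the
second by A, so ⟨m⟩ is normal and N = ⟨m⟩. -/
theorem card_prime_of_inf_eq_bot [Finite G] (h : IsMutuallyPermutableProduct A B) (hN : IsMinimalNormal N)
    (hA : N ⊓ A = ⊥) (hB : N ⊓ B = ⊥) : (Nat.card N).Prime := by
  have := hN.normal
  obtain ⟨n, hnN, hn1⟩ := N.bot_or_exists_ne_one.resolve_left hN.ne_bot
  obtain ⟨a, ha, b, hb, hab⟩ := h.exists_mul_eq n
  have hbotA : ∀ x ∈ N, x ∈ A → x = 1 := fun x h1 h2 => by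
    have : x ∈ N ⊓ A := ⟨h1, h2⟩
    rwa [hA] at this
  have hbotB : ∀ x ∈ N, x ∈ B → x = 1 := fun x h1 h2 => by
    have : x ∈ N ⊓ B := ⟨h1, h2⟩
    rwa [hB] at this
  have haB : a ∉ B := fun hh => hn1 (hbotB n hnN (hab ▸ B.mul_mem hh hb))
  obtain ⟨j, r, hr, hcB, hcr⟩ := Subgroup.exists_pow_notMem_pow_prime_mem haB
  set c := a ^ j
  have hcA : c ∈ A := A.pow_mem ha j
  have haNB : a ∈ N ⊔ B := by
    have : a = n * b⁻¹ := by rw [← hab]; group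
    rw [this]
    exact Subgroup.mul_mem_sup hnN (B.inv_mem hb)
  have hcNB : c ∈ N ⊔ B := Subgroup.pow_mem _ haNB j
  obtain ⟨m, hm, d, hd, hmd⟩ := (SubgroupsPermute.of_normal_left N B).mem_sup hcNB
  have hm' : m = c * d⁻¹ := by rw [← hmd]; group
  have hd' : d = m⁻¹ * c := by rw [← hmd]; group
  have hm1 : m ≠ 1 := by
    rintro rfl
    rw [one_mul] at hmd
    exact hcB (hmd ▸ hd)
  have hdA : d ∉ A := fun hh => hm1 (hbotA m hm (hm' ▸ A.mul_mem hcA (A.inv_mem hh)))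
  -- The two powers agree modulo N and both lie in B, while N ∩ B = 1. This makes the roles of (c,
  -- B) and (d, A) symmetric.
  have hdr : d ^ r = c ^ r := by
    have h1 : d ^ r * (c ^ r)⁻¹ ∈ N := by
      rw [← QuotientGroup.eq_one_iff (N := N), QuotientGroup.mk_mul, QuotientGroup.mk_inv,
        QuotientGroup.mk_pow, QuotientGroup.mk_pow, hd', QuotientGroup.mk_mul, QuotientGroup.mk_inv,
        (QuotientGroup.eq_one_iff m).2 hm]
      simp
    exact mul_inv_eq_one.1 (hbotB _ h1 (B.mul_mem (B.pow_mem hd r) (B.inv_mem hcr)))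
  have hcardM := card_inf_sup_zpowers (N := N) hr
    ((h.2.2 _ ((Subgroup.zpowers_le).2 hcA)).symm) hcr hcB hB hcNB
  have hcardM' := card_inf_sup_zpowers (N := N) hr
    ((h.2.1 _ ((Subgroup.zpowers_le).2 hd)).symm) (hdr ▸ A.pow_mem hcA r) hdA hA
    (hd' ▸ Subgroup.mul_mem_sup (N.inv_mem hm) hcA)
  set W := Subgroup.zpowers c ⊔ B with hW
  set W' := Subgroup.zpowers d ⊔ A with hW'
  have hmW : m ∈ N ⊓ W := ⟨hm, hm' ▸ Subgroup.mul_mem_sup (Subgroup.mem_zpowers c) (B.inv_mem hd)⟩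
  have hmW' : m ∈ N ⊓ W' := ⟨hm, hm' ▸ W'.mul_mem (Subgroup.mem_sup_right hcA)
    (W'.inv_mem (Subgroup.mem_sup_left (Subgroup.mem_zpowers d)))⟩
  have hz : ∀ K : Subgroup G, Nat.card K = r → m ∈ K → Subgroup.zpowers m = K := by
    intro K hK hmK
    apply Subgroup.eq_of_le_of_card_ge ((Subgroup.zpowers_le).2 hmK)
    have hdvd : Nat.card (Subgroup.zpowers m) ∣ r :=
      hK ▸ Subgroup.card_dvd_of_le ((Subgroup.zpowers_le).2 hmK)
    rw [Nat.card_zpowers] at hdvd ⊢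
    rcases (Nat.dvd_prime hr).1 hdvd with e | e
    · exact absurd (orderOf_eq_one_iff.1 e) hm1
    · rw [hK, e]
  have e1 := hz _ hcardM hmW
  have e2 := hz _ hcardM' hmW'
  have hnormal : (Subgroup.zpowers m).Normal := by
    apply h.normal_of_conj_mem
    · intro x hx y hy
      rw [e2] at hy ⊢
      have hx' : x ∈ W' := Subgroup.mem_sup_right hx
      exact ⟨hN.normal.conj_mem y hy.1 x, W'.mul_mem (W'.mul_mem hx' hy.2) (W'.inv_mem hx')⟩
    · intro x hx y hy
      rw [e1] at hy ⊢
      have hx' : x ∈ W := Subgroup.mem_sup_right hx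
      exact ⟨hN.normal.conj_mem y hy.1 x, W.mul_mem (W.mul_mem hx' hy.2) (W.inv_mem hx')⟩
  rcases hN.eq_of_le _ hnormal ((Subgroup.zpowers_le).2 hm) with e | e
  · exact absurd (Subgroup.zpowers_eq_bot.1 e) hm1
  · rw [← e, e1, hcardM]; exact hr

theorem inf_permute_inf (h : IsMutuallyPermutableProduct A B) (N : Subgroup G) :
    SubgroupsPermute (N ⊓ A) (N ⊓ B) := by
  rw [inf_comm N A, inf_comm N B]
  exact (h.mutuallyPermutable.inf N).permute

theorem eq_sup_or_card_prime [Finite G] (h : IsMutuallyPermutableProduct A B) (hN : IsMinimalNormal N) :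
    (N ⊓ A) ⊔ (N ⊓ B) = N ∨ (N ⊓ A = ⊥ ∧ N ⊓ B = ⊥ ∧ (Nat.card N).Prime) := by
  have := hN.normal
  rcases hN.eq_of_le _ (h.normal_inf_sup_inf N) (sup_le inf_le_left inf_le_left) with e | e
  · rw [sup_eq_bot_iff] at e
    exact Or.inr ⟨e.1, e.2, h.card_prime_of_inf_eq_bot hN e.1 e.2⟩
  · exact Or.inl e

/-- Writing n = xf with x ∈ N ∩ A and f ∈ N ∩ B, the subgroup ⟨f⟩(N ∩ A) = N ∩ ⟨f⟩A is normalised by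
A. If N has prime order, ⟨n⟩ is trivial or all of N. -/
theorem conj_mem_inf_sup_zpowers [Finite G] (h : IsMutuallyPermutableProduct A B) (hN : IsMinimalNormal N)
    {a n : G} (ha : a ∈ A) (hn : n ∈ N) : a * n * a⁻¹ ∈ (N ⊓ A) ⊔ Subgroup.zpowers n := by
  have := hN.normal
  rcases h.eq_sup_or_card_prime hN with e | ⟨-, -, hp⟩
  · have hn' := hn
    rw [← e] at hn'
    obtain ⟨x, hx, f, hf, rfl⟩ := (h.inf_permute_inf N).mem_sup hn'
    have h1 : a * f * a⁻¹ ∈ Subgroup.zpowers f ⊔ (N ⊓ A) :=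
      MutuallyPermutable.conj_mem_inf_sup (h.2.1 _ ((Subgroup.zpowers_le).2 hf.2)).symm
        ((Subgroup.zpowers_le).2 hf.1) ha (Subgroup.mem_sup_left (Subgroup.mem_zpowers f))
    have h2 : Subgroup.zpowers f ⊔ (N ⊓ A) ≤ (N ⊓ A) ⊔ Subgroup.zpowers (x * f) := by
      refine sup_le ((Subgroup.zpowers_le).2 ?_) le_sup_left
      have := Subgroup.mul_mem_sup ((N ⊓ A).inv_mem hx) (Subgroup.mem_zpowers (x * f))
      rwa [inv_mul_cancel_left] at this
    have h3 : a * x * a⁻¹ ∈ N ⊓ A :=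
      ⟨hN.normal.conj_mem x hx.1 a, A.mul_mem (A.mul_mem ha hx.2) (A.inv_mem ha)⟩
    have h4 : a * (x * f) * a⁻¹ = (a * x * a⁻¹) * (a * f * a⁻¹) := by group
    rw [h4]
    exact Subgroup.mul_mem _ (Subgroup.mem_sup_left h3) (h2 h1)
  · by_cases hn1 : n = 1
    · rw [hn1]; simp
    · have : Subgroup.zpowers n = N := by
        apply Subgroup.eq_of_le_of_card_ge ((Subgroup.zpowers_le).2 hn)
        have hdvd : Nat.card (Subgroup.zpowers n) ∣ Nat.card N :=
          Subgroup.card_dvd_of_le ((Subgroup.zpowers_le).2 hn)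
        rw [Nat.card_zpowers] at hdvd ⊢
        rcases (Nat.dvd_prime hp).1 hdvd with e | e
        · exact absurd (orderOf_eq_one_iff.1 e) hn1
        · rw [e]
      rw [this]
      exact Subgroup.mem_sup_right (hN.normal.conj_mem n hn a)

end IsMutuallyPermutableProduct

end MinimalNormal

/-! ### Actions of q-elements on elementary abelian p-groups. -/

section Coprime

variable {G : Type*} [Group G]

theorem pow_conj_eq_of_commute {g e n : G} (hge : g * e = e * g) (hn : g * n * g⁻¹ = e * n) (t : ℕ) :
    g ^ t * n * (g ^ t)⁻¹ = e ^ t * n := by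
  induction t with
  | zero => simp
  | succ t ih =>
    have h1 : g * e ^ t * g⁻¹ = e ^ t := by
      rw [((show Commute g e from hge).pow_right t).eq]; group
    calc g ^ (t + 1) * n * (g ^ (t + 1))⁻¹ = g * (g ^ t * n * (g ^ t)⁻¹) * g⁻¹ := by
          rw [pow_succ']; group
      _ = (g * e ^ t * g⁻¹) * (g * n * g⁻¹) := by rw [ih]; group
      _ = e ^ (t + 1) * n := by rw [h1, hn, pow_succ]; group

theorem eq_one_of_coprime_pow {e : G} {m n : ℕ} (h : Nat.Coprime m n) (hm : e ^ m = 1) (hn : e ^ n = 1) :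
    e = 1 :=
  orderOf_eq_one_iff.1
    (Nat.eq_one_of_dvd_coprimes h (orderOf_dvd_of_pow_eq_one hm) (orderOf_dvd_of_pow_eq_one hn))

/-- If a `q`-element moves `n` only by a `p`-element it commutes with, then it commutes with `n`. -/
theorem commute_of_conj_eq_mul {p q k l : ℕ} (hp : p.Prime) (hq : q.Prime) (hpq : p ≠ q) {g e n : G}
    (hg : g ^ q ^ k = 1) (he : e ^ p ^ l = 1) (hge : g * e = e * g) (hn : g * n * g⁻¹ = e * n) :
    g * n = n * g := by
  have h1 := pow_conj_eq_of_commute hge hn (q ^ k)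
  rw [hg] at h1
  have h2 : e ^ q ^ k = 1 := by simpa using h1.symm
  have h3 : e = 1 := eq_one_of_coprime_pow
    (Nat.Coprime.pow l k ((Nat.coprime_primes hp hq).2 hpq)) he h2
  rw [h3, one_mul, mul_inv_eq_iff_eq_mul] at hn
  exact hn

/-- Modulo E, g acts on ⟨n⟩ as a power i. Its order in the units of ZMod p divides both q^k and p -
1, so i = 1; then g moves n only by an element of E, and coprimality finishes. -/
theorem commute_of_conj_mem_sup_zpowers {p q k : ℕ} (hp : p.Prime) (hq : q.Prime) (hpq : p ≠ q)
    (hqp : ¬ q ∣ p - 1) {N E : Subgroup G} (hEN : E ≤ N)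
    (hcomm : ∀ x ∈ N, ∀ y ∈ N, x * y = y * x) (hexp : ∀ x ∈ N, x ^ p = 1) {g : G}
    (hg : g ^ q ^ k = 1) (hE : ∀ e ∈ E, g * e = e * g) {n : G} (hn : n ∈ N)
    (hgn : g * n * g⁻¹ ∈ E ⊔ Subgroup.zpowers n) : g * n = n * g := by
  by_cases hnE : n ∈ E
  · exact hE n hnE
  have hperm : SubgroupsPermute E (Subgroup.zpowers n) := by
    apply SubgroupsPermute.of_forall
    rintro z hz x hx
    exact ⟨x, hx, z, hz, hcomm x (hEN hx) z ((Subgroup.zpowers_le).2 hn hz)⟩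
  obtain ⟨e, he, z, ⟨i, rfl⟩, hgn'⟩ := hperm.mem_sup hgn
  replace hgn' : g * n * g⁻¹ = e * n ^ i := hgn'.symm
  have hiter : ∀ t : ℕ, ∃ e' ∈ E, g ^ t * n * (g ^ t)⁻¹ = e' * n ^ (i ^ t) := by
    intro t
    induction t with
    | zero => exact ⟨1, E.one_mem, by simp⟩
    | succ t ih =>
      obtain ⟨e', he', ih⟩ := ih
      refine ⟨e' * e ^ (i ^ t), E.mul_mem he' (E.zpow_mem he _), ?_⟩
      have h1 : g * e' * g⁻¹ = e' := by rw [hE e' he']; group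
      have h2 : (e * n ^ i) ^ (i ^ t) = e ^ (i ^ t) * (n ^ i) ^ (i ^ t) :=
        (show Commute e (n ^ i) from hcomm _ (hEN he) _ (N.zpow_mem hn i)).mul_zpow _
      calc g ^ (t + 1) * n * (g ^ (t + 1))⁻¹ = g * (g ^ t * n * (g ^ t)⁻¹) * g⁻¹ := by
            rw [pow_succ']; group
        _ = (g * e' * g⁻¹) * (g * n ^ (i ^ t) * g⁻¹) := by rw [ih]; group
        _ = e' * (g * n * g⁻¹) ^ (i ^ t) := by rw [h1, conj_zpow]
        _ = _ := by rw [hgn', h2, ← zpow_mul, ← pow_succ', mul_assoc]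
  obtain ⟨e', he', h1⟩ := hiter (q ^ k)
  rw [hg] at h1
  -- Because g^(q^k) = 1, the q^k-th iterate of the action fixes n. Since n ∉ E, this exponent must
  -- be divisible by p.
  have hT : n ^ (i ^ q ^ k - 1) ∈ E := by
    have : n ^ (i ^ q ^ k - 1) = e'⁻¹ := by
      rw [zpow_sub_one]
      have h2 : n = e' * n ^ (i ^ q ^ k) := by simpa using h1
      rw [eq_inv_iff_mul_eq_one]
      have h3 : n ^ (i ^ q ^ k) = e'⁻¹ * n := by rw [eq_inv_mul_iff_mul_eq]; exact h2.symm
      rw [h3]; group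
    rw [this]
    exact E.inv_mem he'
  have hmemE : ∀ m : ℤ, n ^ m ∈ E → (p : ℤ) ∣ m := by
    intro m hm
    by_contra hnd
    have hco : IsCoprime (p : ℤ) m := (Int.isCoprime_iff_gcd_eq_one).2
      ((Int.isCoprime_iff_gcd_eq_one).1
        ((Prime.coprime_iff_not_dvd (Nat.prime_iff_prime_int.1 hp)).2 hnd))
    obtain ⟨u, v, huv⟩ := hco
    apply hnE
    have : n = (n ^ m) ^ v := by
      rw [← zpow_mul]
      calc n = n ^ (u * p + v * m) := by rw [huv, zpow_one]
        _ = (n ^ (p : ℤ)) ^ u * n ^ (v * m) := by rw [zpow_add, mul_comm u, zpow_mul]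
        _ = _ := by rw [zpow_natCast, hexp n hn, one_zpow, one_mul, mul_comm]
    rw [this]
    exact E.zpow_mem hm v
  have := Fact.mk hp
  have hi1 : (i : ZMod p) ^ q ^ k = 1 := by
    have h2 := hmemE _ hT
    rw [← ZMod.intCast_zmod_eq_zero_iff_dvd] at h2
    push_cast at h2
    exact sub_eq_zero.1 h2
  have hi0 : (i : ZMod p) ≠ 0 := by
    intro h0
    rw [h0, zero_pow (pow_ne_zero _ hq.ne_zero)] at hi1
    exact zero_ne_one hi1
  have hi2 := ZMod.pow_card_sub_one_eq_one hi0
  have hco : Nat.Coprime (q ^ k) (p - 1) := Nat.Coprime.pow_left k ((hq.coprime_iff_not_dvd).2 hqp)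
  have hi : (i : ZMod p) = 1 := orderOf_eq_one_iff.1
    (Nat.eq_one_of_dvd_coprimes hco (orderOf_dvd_of_pow_eq_one hi1) (orderOf_dvd_of_pow_eq_one hi2))
  have hni : n ^ i = n := by
    have h2 : (p : ℤ) ∣ i - 1 := by
      rw [← ZMod.intCast_zmod_eq_zero_iff_dvd]; push_cast; rw [hi, sub_self]
    obtain ⟨c, hc⟩ := h2
    have h3 : i = p * c + 1 := by linarith
    rw [h3, zpow_add, zpow_mul, zpow_natCast, hexp n hn, one_zpow, one_mul, zpow_one]
  rw [hni] at hgn'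
  exact commute_of_conj_eq_mul (l := 1) hp hq hpq hg (by rw [pow_one]; exact hexp e (hEN he)) (hE e he) hgn'

end Coprime

/-! ### Detecting the index of a centraliser on q-elements; the arithmetical condition. -/

section QElements

variable {G : Type*} [Group G]

theorem Subgroup.mem_of_not_dvd_index {C : Subgroup G} [C.Normal] {q k : ℕ}
    (hq : q.Prime) (h : ¬ q ∣ C.index) {g : G} (hg : g ^ q ^ k = 1) : g ∈ C := by
  rw [← QuotientGroup.eq_one_iff (N := C)]
  refine eq_one_of_coprime_pow (Nat.Coprime.pow_left k ((hq.coprime_iff_not_dvd).2 h)) ?_ ?_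
  · rw [← QuotientGroup.mk_pow, hg, QuotientGroup.mk_one]
  · rw [← QuotientGroup.mk_pow, QuotientGroup.eq_one_iff]
    exact C.pow_index_mem g

theorem Subgroup.not_dvd_index_of_forall_mem [Finite G] {C : Subgroup G} {q : ℕ} (hq : q.Prime)
    (h : ∀ g : G, (∃ k : ℕ, g ^ q ^ k = 1) → g ∈ C) : ¬ q ∣ C.index := by
  have := Fact.mk hq
  let Q : Sylow q G := default
  intro hd
  refine Q.not_dvd_index (hd.trans (Subgroup.index_dvd_of_le ?_))
  intro g hg
  obtain ⟨k, hk⟩ := Q.isPGroup' ⟨g, hg⟩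
  exact h g ⟨k, congrArg Subtype.val hk⟩

theorem Subgroup.not_dvd_relIndex_of_forall_mem [Finite G] {C H : Subgroup G} {q : ℕ} (hq : q.Prime)
    (h : ∀ g ∈ H, (∃ k : ℕ, g ^ q ^ k = 1) → g ∈ C) : ¬ q ∣ C.relIndex H := by
  refine Subgroup.not_dvd_index_of_forall_mem hq ?_
  rintro ⟨g, hg⟩ ⟨k, hk⟩
  exact Subgroup.mem_subgroupOf.2 (h g hg ⟨k, congrArg Subtype.val hk⟩)

/-- If `G = AB` and `C` is a normal subgroup that contains the `q`-elements of `A` and of `B`, then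
the index of `C` is prime to `q`. -/
theorem not_dvd_index_of_factors [Finite G] {A B C : Subgroup G} [C.Normal] {q : ℕ} (hq : q.Prime)
    (hperm : SubgroupsPermute A B) (htop : A ⊔ B = ⊤)
    (hA : ∀ g ∈ A, (∃ k : ℕ, g ^ q ^ k = 1) → g ∈ C)
    (hB : ∀ g ∈ B, (∃ k : ℕ, g ^ q ^ k = 1) → g ∈ C) : ¬ q ∣ C.index := by
  intro hd
  have h1 := (hperm.map (QuotientGroup.mk' C)).card_sup_dvd
  rw [← Subgroup.map_sup, htop, Subgroup.map_top_of_surjective _ (QuotientGroup.mk'_surjective C),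
    Subgroup.card_top, ← Subgroup.relIndex_ker, ← Subgroup.relIndex_ker, QuotientGroup.ker_mk'] at h1
  rcases (hq.dvd_mul).1 ((hd : q ∣ Nat.card (G ⧸ C)).trans h1) with h2 | h2
  · exact Subgroup.not_dvd_relIndex_of_forall_mem hq hA h2
  · exact Subgroup.not_dvd_relIndex_of_forall_mem hq hB h2

theorem eq_one_of_not_dvd_card [Finite G] {A : Subgroup G} {q k : ℕ} (hq : q.Prime)
    (h : ¬ q ∣ Nat.card A) {g : G} (hg : g ∈ A) (hgq : g ^ q ^ k = 1) : g = 1 := by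
  refine eq_one_of_coprime_pow (Nat.Coprime.pow_left k ((hq.coprime_iff_not_dvd).2 h)) hgq ?_
  have := pow_card_eq_one' (x := (⟨g, hg⟩ : A))
  exact congrArg Subtype.val this

/-- The arithmetical condition that excludes the edge `(p, q)` from the graph `Γ(A, B)`. -/
def NotLinked (p q : ℕ) {G : Type*} [Group G] (A B : Subgroup G) : Prop :=
  ¬ q ∣ p - 1 ∨ (¬ p ∣ Nat.card A ∧ ¬ q ∣ Nat.card A) ∨ (¬ p ∣ Nat.card B ∧ ¬ q ∣ Nat.card B)

theorem NotLinked.symm {p q : ℕ} {A B : Subgroup G} (h : NotLinked p q A B) : NotLinked p q B A := by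
  unfold NotLinked at *
  tauto

theorem NotLinked.map [Finite G] {G' : Type*} [Group G'] {p q : ℕ} {A B : Subgroup G}
    (h : NotLinked p q A B) (f : G →* G') : NotLinked p q (A.map f) (B.map f) := by
  have hc : ∀ (C : Subgroup G) (r : ℕ), ¬ r ∣ Nat.card C → ¬ r ∣ Nat.card (C.map f) :=
    fun C r hr hd => hr (hd.trans (C.card_map_dvd f))
  rcases h with h | ⟨h1, h2⟩ | ⟨h1, h2⟩
  · exact Or.inl h
  · exact Or.inr (Or.inl ⟨hc _ _ h1, hc _ _ h2⟩)
  · exact Or.inr (Or.inr ⟨hc _ _ h1, hc _ _ h2⟩)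

variable {A B N : Subgroup G} {p q : ℕ}

/-- Here N ∩ A = 1. If N also met B trivially, |N||B| = |NB| would divide |A||B|, and p would divide
|A|. -/
theorem IsMutuallyPermutableProduct.le_of_not_dvd_card [Finite G] (h : IsMutuallyPermutableProduct A B)
    (hN : IsMinimalNormal N) (hp : p.Prime) (hexp : ∀ x ∈ N, x ^ p = 1)
    (hA : ¬ p ∣ Nat.card A) : N ≤ B := by
  have := hN.normal
  have hbot : ∀ C : Subgroup G, ¬ p ∣ Nat.card C → N ⊓ C = ⊥ := by
    intro C hC
    rw [eq_bot_iff]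
    intro x hx
    exact eq_one_of_not_dvd_card (k := 1) hp hC hx.2 (by rw [pow_one]; exact hexp x hx.1)
  rcases h.eq_sup_or_card_prime hN with e | ⟨-, h2, h3⟩
  · rw [hbot A hA, bot_sup_eq] at e
    exact inf_eq_left.1 e
  · exfalso
    obtain ⟨x, hx, hx1⟩ := N.bot_or_exists_ne_one.resolve_left hN.ne_bot
    have hox : orderOf x = p := by
      have := Fact.mk hp
      exact orderOf_eq_prime (hexp x hx) hx1
    have hpN : p ∣ Nat.card N := by
      rw [← hox, ← Subgroup.orderOf_mk (H := N) x hx]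
      exact orderOf_dvd_natCard _
    have h4 := (SubgroupsPermute.of_normal_left N B).symm.card_sup
    rw [← Subgroup.inf_relIndex_right, h2, Subgroup.relIndex_bot_left] at h4
    have h5 : Nat.card N * Nat.card B ∣ Nat.card A * Nat.card B := by
      rw [← h4]
      exact (Subgroup.card_subgroup_dvd_card _).trans h.card_dvd
    exact hA (hpN.trans (Nat.dvd_of_mul_dvd_mul_right Nat.card_pos h5))

theorem IsMutuallyPermutableProduct.commute_of_elementary_left [Finite G]
    (h : IsMutuallyPermutableProduct A B)
    (hN : IsMinimalNormal N) (hp : p.Prime) (hq : q.Prime) (hpq : p ≠ q) (hlink : NotLinked p q A B)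
    (hcomm : ∀ x ∈ N, ∀ y ∈ N, x * y = y * x) (hexp : ∀ x ∈ N, x ^ p = 1)
    (hA : ∀ g ∈ A, (∃ k : ℕ, g ^ q ^ k = 1) → ∀ x ∈ N ⊓ A, g * x = x * g)
    {g : G} (hg : g ∈ A) (hgq : ∃ k : ℕ, g ^ q ^ k = 1) : ∀ x ∈ N, g * x = x * g := by
  intro x hx
  obtain ⟨k, hk⟩ := hgq
  rcases hlink with h1 | ⟨-, h1⟩ | ⟨h1, -⟩
  · exact commute_of_conj_mem_sup_zpowers hp hq hpq h1 (E := N ⊓ A) inf_le_left hcomm hexp hk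
      (hA g hg ⟨k, hk⟩) hx (h.conj_mem_inf_sup_zpowers hN hg hx)
  · rw [eq_one_of_not_dvd_card hq h1 hg hk]; simp
  · exact hA g hg ⟨k, hk⟩ x ⟨hx, h.symm.le_of_not_dvd_card hN hp hexp h1 hx⟩

theorem IsMutuallyPermutableProduct.commute_of_elementary [Finite G]
    (h : IsMutuallyPermutableProduct A B)
    (hN : IsMinimalNormal N) (hp : p.Prime) (hq : q.Prime) (hpq : p ≠ q) (hlink : NotLinked p q A B)
    (hcomm : ∀ x ∈ N, ∀ y ∈ N, x * y = y * x) (hexp : ∀ x ∈ N, x ^ p = 1)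
    (hA : ∀ g ∈ A, (∃ k : ℕ, g ^ q ^ k = 1) → ∀ x ∈ N ⊓ A, g * x = x * g)
    (hB : ∀ g ∈ B, (∃ k : ℕ, g ^ q ^ k = 1) → ∀ x ∈ N ⊓ B, g * x = x * g) :
    ¬ q ∣ (Subgroup.centralizer (N : Set G)).index := by
  have := hN.normal
  refine not_dvd_index_of_factors hq h.mutuallyPermutable.permute h.sup_eq_top ?_ ?_
  · intro g hg hgq
    rw [Subgroup.mem_centralizer_iff]
    intro x hx
    exact (h.commute_of_elementary_left hN hp hq hpq hlink hcomm hexp hA hg hgq x hx).symm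
  · intro g hg hgq
    rw [Subgroup.mem_centralizer_iff]
    intro x hx
    exact (h.symm.commute_of_elementary_left hN hp hq hpq hlink.symm hcomm hexp hB hg hgq x hx).symm

end QElements

/-! ### Nonsoluble minimal normal subgroups. -/

section Nonsoluble

variable {G : Type*} [Group G]

theorem SubgroupsPermute.sup_left {K L H : Subgroup G} (h : SubgroupsPermute K L)
    (hK : SubgroupsPermute K H) (hL : SubgroupsPermute L H) : SubgroupsPermute (K ⊔ L) H := by
  apply SubgroupsPermute.of_forall
  intro y hy x hx
  obtain ⟨u, hu, v, hv, rfl⟩ := h.mem_sup hx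
  obtain ⟨u', hu', y', hy', e⟩ := hK.exists_mul_eq hy hu
  obtain ⟨v', hv', y'', hy'', e'⟩ := hL.exists_mul_eq hy' hv
  refine ⟨u' * v', Subgroup.mul_mem_sup hu' hv', y'', hy'', ?_⟩
  rw [mul_assoc, e', ← mul_assoc, e, mul_assoc]

theorem isSolvable_of_forall_conj_mem [Finite G] {N : Subgroup G}
    (h : ∀ H ≤ N, ∀ n ∈ N, ∀ x ∈ H, n * x * n⁻¹ ∈ H) : Group.IsSolvable N := by
  have : Group.IsNilpotent N := by
    -- Items 0 and 3 of the list are nilpotency and normality of all Sylow subgroups.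
    refine ((Group.isNilpotent_of_finite_tfae (G := N)).out 0 3).2 ?_
    intro p _ P
    constructor
    intro x hx n
    have := h ((P : Subgroup N).map N.subtype) (Subgroup.map_subtype_le _) n n.2 x ⟨x, hx, rfl⟩
    obtain ⟨y, hy, e⟩ := this
    have e' : y = n * x * n⁻¹ := Subtype.ext e
    exact e' ▸ hy
  infer_instance

/-- A nonsoluble minimal normal subgroup contains no nontrivial soluble subgroup that permutes with
all its subgroups. -/
theorem IsMinimalNormal.eq_bot_of_permute [Finite G] {N F : Subgroup G} (hN : IsMinimalNormal N)
    (hns : ¬ Group.IsSolvable N) (hFN : F ≤ N) (hF : Group.IsSolvable F)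
    (hperm : ∀ H ≤ N, SubgroupsPermute F H) : F = ⊥ := by
  have := hN.normal
  let S : Set (Subgroup G) := {K | K ≤ N ∧ Group.IsSolvable K ∧ ∀ H ≤ N, SubgroupsPermute K H}
  -- A maximal soluble M that permutes with all subgroups of N absorbs its conjugates: M and a
  -- conjugate are mutually permutable, so their product is again soluble. Hence M is normal in G,
  -- and M = 1.
  obtain ⟨M, hFM, hM⟩ := (Set.toFinite S).exists_le_maximal (show F ∈ S from ⟨hFN, hF, hperm⟩)
  obtain ⟨hMN, hMs, hMp⟩ := hM.prop
  have hconjN : ∀ (g : G) (H : Subgroup G), H ≤ N → H.map (MulAut.conj g).toMonoidHom ≤ N := by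
    rintro g H hH _ ⟨x, hx, rfl⟩
    exact hN.normal.conj_mem x (hH hx) g
  have hnormal : M.Normal := by
    constructor
    intro x hx g
    set K := M.map (MulAut.conj g).toMonoidHom with hK
    have hKN : K ≤ N := hconjN g M hMN
    have hKs : Group.IsSolvable K :=
      Group.isSolvable_of_surjective (MonoidHom.subgroupMap_surjective (MulAut.conj g).toMonoidHom M)
    have hKp : ∀ H ≤ N, SubgroupsPermute K H := by
      intro H hH
      have h1 := (hMp _ (hconjN g⁻¹ H hH)).map (MulAut.conj g).toMonoidHom
      have h2 : (H.map (MulAut.conj g⁻¹).toMonoidHom).map (MulAut.conj g).toMonoidHom = H := by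
        rw [Subgroup.map_map]
        convert Subgroup.map_id H
        ext y
        simp [mul_assoc]
      rwa [h2] at h1
    have hMK : MutuallyPermutable M K :=
      ⟨fun L hL => hMp L (hL.trans hKN), fun L hL => hKp L (hL.trans hMN)⟩
    have hsup : M ⊔ K ∈ S := ⟨sup_le hMN hKN, hMK.isSolvable_sup hMs hKs,
      fun H hH => hMK.permute.sup_left (hMp H hH) (hKp H hH)⟩
    exact hM.le_of_ge hsup le_sup_left (Subgroup.mem_sup_right ⟨x, hx, rfl⟩)
  rcases hN.eq_of_le M hnormal hMN with e | e
  · rw [eq_bot_iff, ← e]; exact hFM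
  · exact absurd (e ▸ hMs) hns

namespace IsMutuallyPermutableProduct

variable {A B N : Subgroup G}

theorem le_of_not_isSolvable_inf [Finite G] (h : IsMutuallyPermutableProduct A B)
    (hN : IsMinimalNormal N) (hE : ¬ Group.IsSolvable (N ⊓ A : Subgroup G)) : N ≤ A := by
  obtain ⟨P, hP, hPP, hPb⟩ := Subgroup.exists_perfect_ne_bot hE
  rcases hN.le_or_inf_eq_bot h.perfectResidual_normal with h1 | h1
  · exact h1.trans (perfectResidual_le A)
  · exfalso
    apply hPb
    rw [eq_bot_iff, ← h1]
    exact le_inf (hP.trans inf_le_left) (le_perfectResidual (hP.trans inf_le_right) hPP)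

/-- Otherwise N ∩ A and N ∩ B are soluble, and N is their mutually permutable product or has prime
order; it would be soluble. -/
theorem le_or_le_of_not_isSolvable [Finite G] (h : IsMutuallyPermutableProduct A B)
    (hN : IsMinimalNormal N) (hns : ¬ Group.IsSolvable N) : N ≤ A ∨ N ≤ B := by
  by_contra hc
  push Not at hc
  have hE : Group.IsSolvable (N ⊓ A : Subgroup G) := by
    by_contra h1
    exact hc.1 (h.le_of_not_isSolvable_inf hN h1)
  have hF : Group.IsSolvable (N ⊓ B : Subgroup G) := by
    by_contra h1
    exact hc.2 (h.symm.le_of_not_isSolvable_inf hN h1)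
  apply hns
  rcases h.eq_sup_or_card_prime hN with e | ⟨-, -, hp⟩
  · rw [← e]
    refine MutuallyPermutable.isSolvable_sup ?_ hE hF
    rw [inf_comm N A, inf_comm N B]
    exact h.mutuallyPermutable.inf N
  · have := Fact.mk hp
    have := isCyclic_of_prime_card (α := N) rfl
    exact Group.isSolvable_of_comm (IsCyclic.commGroup (α := N)).mul_comm

/-- N ∩ B is soluble and permutes with all subgroups of N, so it is trivial. Then B normalises every
H = BH ∩ N with H ≤ N. The intersection W of all these normalisers is normal in G and cannot contain
N, or N would be nilpotent; so W meets N trivially and centralises it. -/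
theorem commute_of_le_left [Finite G] (h : IsMutuallyPermutableProduct A B)
    (hN : IsMinimalNormal N) (hns : ¬ Group.IsSolvable N) (hNA : N ≤ A) (hNB : ¬ N ≤ B) :
    ∀ b ∈ B, ∀ x ∈ N, b * x = x * b := by
  have := hN.normal
  have hF : Group.IsSolvable (N ⊓ B : Subgroup G) := by
    by_contra h1
    exact hNB (h.symm.le_of_not_isSolvable_inf hN h1)
  have hbot : N ⊓ B = ⊥ := by
    refine hN.eq_bot_of_permute hns inf_le_left hF ?_
    intro H hH
    rw [inf_comm]
    exact ((h.2.2 H (hH.trans hNA)).symm.inf_right hH).symm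
  let W : Subgroup G := ⨅ H : {H : Subgroup G // H ≤ N}, Subgroup.normalizer ((H : Subgroup G) : Set G)
  have hmemW : ∀ g : G, (∀ H ≤ N, ∀ x ∈ H, g * x * g⁻¹ ∈ H) → g ∈ W := by
    intro g hg
    refine Subgroup.mem_iInf.2 fun H => ?_
    exact Subgroup.mem_normalizer_of_conj_mem (hg H H.2)
  have hWmem : ∀ g ∈ W, ∀ H ≤ N, ∀ x ∈ H, g * x * g⁻¹ ∈ H := by
    intro g hg H hH x hx
    exact Subgroup.normalizer_conj_mem (Subgroup.mem_iInf.1 hg ⟨H, hH⟩) hx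
  have hBW : B ≤ W := by
    intro b hb
    refine hmemW b fun H hH x hx => ?_
    have := MutuallyPermutable.conj_mem_inf_sup (h.2.2 H (hH.trans hNA)).symm hH hb
      (Subgroup.mem_sup_left hx)
    rwa [hbot, sup_bot_eq] at this
  have hW : W.Normal := by
    constructor
    intro g hg t
    refine hmemW _ fun H hH x hx => ?_
    have hH' : H.map (MulAut.conj t⁻¹).toMonoidHom ≤ N := by
      rintro _ ⟨y, hy, rfl⟩
      exact hN.normal.conj_mem y (hH hy) t⁻¹
    obtain ⟨y, hy, e⟩ := hWmem g hg _ hH' (t⁻¹ * x * t) ⟨x, hx, by simp⟩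
    have e' : t⁻¹ * y * t = g * (t⁻¹ * x * t) * g⁻¹ := by simpa using e
    have : t * g * t⁻¹ * x * (t * g * t⁻¹)⁻¹ = y := by
      calc t * g * t⁻¹ * x * (t * g * t⁻¹)⁻¹ = t * (g * (t⁻¹ * x * t) * g⁻¹) * t⁻¹ := by group
        _ = y := by rw [← e']; group
    rw [this]; exact hy
  rcases hN.le_or_inf_eq_bot hW with h1 | h1
  · exfalso
    exact hns (isSolvable_of_forall_conj_mem fun H hH n hn x hx => hWmem n (h1 hn) H hH x hx)
  · intro b hb x hx
    exact hN.commute_of_inf_eq_bot hW h1 (hBW hb) hx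

/-- A factor of a mutually permutable product either contains or centralises a given nonsoluble
minimal normal subgroup. -/
theorem le_or_commute_of_not_isSolvable [Finite G] (h : IsMutuallyPermutableProduct A B)
    (hN : IsMinimalNormal N) (hns : ¬ Group.IsSolvable N) :
    N ≤ A ∨ ∀ a ∈ A, ∀ x ∈ N, a * x = x * a := by
  rcases h.le_or_le_of_not_isSolvable hN hns with h1 | h1
  · exact Or.inl h1
  · by_cases hA : N ≤ A
    · exact Or.inl hA
    · exact Or.inr (h.symm.commute_of_le_left hN hns h1 hA)

end IsMutuallyPermutableProduct

end Nonsoluble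

/-! ### Normal p'-subgroups of index prime to q (Hawkes graph). -/

section PrimeByPrime

/-- `G` has a normal `p'`-subgroup whose index is prime to `q`. -/
def IsPPrimeByQPrime (p q : ℕ) (G : Type*) [Group G] : Prop :=
  ∃ K : Subgroup G, K.Normal ∧ ¬ p ∣ Nat.card K ∧ ¬ q ∣ K.index

theorem IsPPrimeByQPrime.of_surjective {G G' : Type*} [Group G] [Group G'] {p q : ℕ}
    (h : IsPPrimeByQPrime p q G) (f : G →* G') (hf : Function.Surjective f) :
    IsPPrimeByQPrime p q G' := by
  obtain ⟨K, hK, hp, hq⟩ := h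
  exact ⟨K.map f, hK.map f hf, fun h => hp (h.trans (K.card_map_dvd f)),
    fun h => hq (h.trans (K.index_map_dvd hf))⟩

theorem IsPPrimeByQPrime.map {G G' : Type*} [Group G] [Group G'] {p q : ℕ} {A : Subgroup G}
    (h : IsPPrimeByQPrime p q A) (f : G →* G') : IsPPrimeByQPrime p q (A.map f) :=
  h.of_surjective (f.subgroupMap A) (f.subgroupMap_surjective A)

variable {G : Type*} [Group G] {A B N : Subgroup G} {p q : ℕ}

theorem SubgroupsPermute.of_le_normalizer {H K : Subgroup G}
    (h : K ≤ Subgroup.normalizer (H : Set G)) : SubgroupsPermute H K := by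
  apply SubgroupsPermute.of_forall
  intro k hk x hx
  exact ⟨k * x * k⁻¹, Subgroup.normalizer_conj_mem (h hk) hx, k, hk, by group⟩

/-- A minimal normal subgroup of order divisible by `p` has no nontrivial normal `p'`-subgroup. -/
theorem IsMinimalNormal.eq_bot_of_not_dvd_card [Finite G] (hN : IsMinimalNormal N) (hp : p.Prime)
    (hpN : p ∣ Nat.card N) {T : Subgroup G} (hTN : T ≤ N)
    (hT : N ≤ Subgroup.normalizer (T : Set G)) (hpT : ¬ p ∣ Nat.card T) : T = ⊥ := by
  have := hN.normal
  let S : Set (Subgroup G) := {K | K ≤ N ∧ N ≤ Subgroup.normalizer (K : Set G) ∧ ¬ p ∣ Nat.card K}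
  -- The product of M with a conjugate is again a p'-subgroup normalised by N, so a maximal such M
  -- is normal in G.
  obtain ⟨M, hTM, hM⟩ := (Set.toFinite S).exists_le_maximal (show T ∈ S from ⟨hTN, hT, hpT⟩)
  obtain ⟨hMN, hMn, hMp⟩ := hM.prop
  have hnormal : M.Normal := by
    constructor
    intro x hx g
    set K := M.map (MulAut.conj g).toMonoidHom with hK
    have hKN : K ≤ N := by
      rintro _ ⟨x, hx, rfl⟩
      exact hN.normal.conj_mem x (hMN hx) g
    have hKn : N ≤ Subgroup.normalizer (K : Set G) := by
      intro n hn
      refine Subgroup.mem_normalizer_of_conj_mem ?_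
      rintro _ ⟨y, hy, rfl⟩
      have hn' : g⁻¹ * n * g ∈ N := by simpa using hN.normal.conj_mem n hn g⁻¹
      exact ⟨_, Subgroup.normalizer_conj_mem (hMn hn') hy, by simp [mul_assoc]⟩
    have hKp : ¬ p ∣ Nat.card K := fun h => hMp (h.trans (M.card_map_dvd _))
    have hsup : M ⊔ K ∈ S := by
      refine ⟨sup_le hMN hKN, ?_, ?_⟩
      · intro n hn
        have hle : (M ⊔ K).map (MulAut.conj n).toMonoidHom ≤ M ⊔ K := by
          rw [Subgroup.map_sup]
          refine sup_le_sup ?_ ?_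
          · rintro _ ⟨y, hy, rfl⟩
            exact Subgroup.normalizer_conj_mem (hMn hn) hy
          · rintro _ ⟨y, hy, rfl⟩
            exact Subgroup.normalizer_conj_mem (hKn hn) hy
        exact Subgroup.mem_normalizer_of_conj_mem fun y hy => hle ⟨y, hy, rfl⟩
      · intro hd
        have h1 := (SubgroupsPermute.of_le_normalizer (hKN.trans hMn)).card_sup_dvd
        rcases (hp.dvd_mul).1 (hd.trans h1) with h2 | h2
        · exact hMp h2
        · exact hKp h2
    exact hM.le_of_ge hsup le_sup_left (Subgroup.mem_sup_right ⟨x, hx, rfl⟩)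
  rcases hN.eq_of_le M hnormal hMN with e | e
  · rw [eq_bot_iff, ← e]; exact hTM
  · exact absurd hpN (e ▸ hMp)

theorem exists_subgroup_of_isPPrimeByQPrime [Finite G] (hq : q.Prime) (h : IsPPrimeByQPrime p q A) :
    ∃ K ≤ A, (A ≤ Subgroup.normalizer (K : Set G)) ∧ ¬ p ∣ Nat.card K ∧
      ∀ g ∈ A, (∃ k : ℕ, g ^ q ^ k = 1) → g ∈ K := by
  obtain ⟨K, hK, hKp, hKq⟩ := h
  refine ⟨K.map A.subtype, Subgroup.map_subtype_le K, ?_, fun h => hKp (h.trans (K.card_map_dvd _)), ?_⟩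
  · intro a ha
    refine Subgroup.mem_normalizer_of_conj_mem ?_
    rintro _ ⟨y, hy, rfl⟩
    exact ⟨_, hK.conj_mem y hy ⟨a, ha⟩, rfl⟩
  · rintro g hg ⟨k, hk⟩
    have h1 : (⟨g, hg⟩ : A) ∈ K := Subgroup.mem_of_not_dvd_index (k := k) hq hKq (Subtype.ext hk)
    exact ⟨_, h1, rfl⟩

/-- The commutator of g and x lies both in N, of exponent p, and in the normal p'-subgroup of A that
contains g. -/
theorem commute_of_isPPrimeByQPrime [Finite G] [N.Normal] (hp : p.Prime) (hq : q.Prime)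
    (hexp : ∀ x ∈ N, x ^ p = 1)
    (h : IsPPrimeByQPrime p q A) {g : G} (hg : g ∈ A) (hgq : ∃ k : ℕ, g ^ q ^ k = 1) :
    ∀ x ∈ N ⊓ A, g * x = x * g := by
  obtain ⟨K, hKA, hKn, hKp, hKq⟩ := exists_subgroup_of_isPPrimeByQPrime hq h
  rintro x ⟨hxN, hxA⟩
  have hgK := hKq g hg hgq
  have h1 : g * x * g⁻¹ * x⁻¹ ∈ N :=
    N.mul_mem (Subgroup.Normal.conj_mem inferInstance x hxN g) (N.inv_mem hxN)
  have h2 : g * x * g⁻¹ * x⁻¹ ∈ K := by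
    have := K.mul_mem hgK (Subgroup.normalizer_conj_mem (hKn hxA) (K.inv_mem hgK))
    simpa [mul_assoc] using this
  have h3 := eq_one_of_not_dvd_card (k := 1) hp hKp h2 (by rw [pow_one]; exact hexp _ h1)
  rwa [mul_inv_eq_one, mul_inv_eq_iff_eq_mul] at h3

theorem commute_of_isPPrimeByQPrime_of_le [Finite G] (hN : IsMinimalNormal N) (hp : p.Prime)
    (hq : q.Prime) (hpN : p ∣ Nat.card N) (hNA : N ≤ A)
    (h : IsPPrimeByQPrime p q A) {g : G} (hg : g ∈ A) (hgq : ∃ k : ℕ, g ^ q ^ k = 1) :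
    ∀ x ∈ N, g * x = x * g := by
  have := hN.normal
  obtain ⟨K, hKA, hKn, hKp, hKq⟩ := exists_subgroup_of_isPPrimeByQPrime hq h
  have hbot : K ⊓ N = ⊥ := by
    refine hN.eq_bot_of_not_dvd_card hp hpN inf_le_right ?_
      (fun hd => hKp (hd.trans (Subgroup.card_dvd_of_le inf_le_left)))
    intro n hn
    refine Subgroup.mem_normalizer_of_conj_mem fun x hx => ?_
    exact ⟨Subgroup.normalizer_conj_mem (hKn (hNA hn)) hx.1, hN.normal.conj_mem x hx.2 n⟩
  intro x hxN
  have hgK := hKq g hg hgq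
  have h1 : g * x * g⁻¹ * x⁻¹ ∈ N := N.mul_mem (hN.normal.conj_mem x hxN g) (N.inv_mem hxN)
  have h2 : g * x * g⁻¹ * x⁻¹ ∈ K := by
    have := K.mul_mem hgK (Subgroup.normalizer_conj_mem (hKn (hNA hxN)) (K.inv_mem hgK))
    simpa [mul_assoc] using this
  have h3 : g * x * g⁻¹ * x⁻¹ ∈ K ⊓ N := ⟨h2, h1⟩
  rw [hbot, Subgroup.mem_bot] at h3
  rwa [mul_inv_eq_one, mul_inv_eq_iff_eq_mul] at h3

theorem IsMutuallyPermutableProduct.not_dvd_index_centralizer [Finite G]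
    (h : IsMutuallyPermutableProduct A B) (hN : IsMinimalNormal N) (hp : p.Prime) (hq : q.Prime)
    (hpq : p ≠ q) (hlink : NotLinked p q A B) (hpN : p ∣ Nat.card N)
    (hA : IsPPrimeByQPrime p q A) (hB : IsPPrimeByQPrime p q B) :
    ¬ q ∣ (Subgroup.centralizer (N : Set G)).index := by
  have := hN.normal
  by_cases hs : Group.IsSolvable N
  · obtain ⟨hcomm, hexp⟩ := hN.elementary_of_isSolvable hs hp hpN
    exact h.commute_of_elementary hN hp hq hpq hlink hcomm hexp
      (fun g hg hgq => commute_of_isPPrimeByQPrime hp hq hexp hA hg hgq)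
      (fun g hg hgq => commute_of_isPPrimeByQPrime hp hq hexp hB hg hgq)
  · refine not_dvd_index_of_factors hq h.mutuallyPermutable.permute h.sup_eq_top ?_ ?_
    · intro g hg hgq
      refine Subgroup.mem_centralizer_iff.2 fun x hx => ?_
      rcases h.le_or_commute_of_not_isSolvable hN hs with h1 | h1
      · exact (commute_of_isPPrimeByQPrime_of_le hN hp hq hpN h1 hA hg hgq x hx).symm
      · exact (h1 g hg x hx).symm
    · intro g hg hgq
      refine Subgroup.mem_centralizer_iff.2 fun x hx => ?_
      rcases h.symm.le_or_commute_of_not_isSolvable hN hs with h1 | h1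
      · exact (commute_of_isPPrimeByQPrime_of_le hN hp hq hpN h1 hB hg hgq x hx).symm
      · exact (h1 g hg x hx).symm

theorem coprime_card_of_exponent [Finite G] {p m : ℕ} (hp : p.Prime) (hexp : ∀ x ∈ N, x ^ p = 1)
    (hm : ¬ p ∣ m) : Nat.Coprime (Nat.card N) m := by
  refine Nat.coprime_of_dvd fun s hs h1 h2 => hm ?_
  have := Fact.mk hs
  obtain ⟨x, hx⟩ := exists_prime_orderOf_dvd_card' s h1
  have h3 : s ∣ p := by
    rw [← hx]
    exact orderOf_dvd_of_pow_eq_one (Subtype.ext (hexp x x.2))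
  rwa [(Nat.prime_dvd_prime_iff_eq hs hp).1 h3] at h2

/-- A normal subgroup with central Sylow `p`-subgroup `N` of exponent `p` has a normal `p`-complement. -/
theorem isPPrimeByQPrime_of_central [Finite G] [N.Normal] (hp : p.Prime) (hq : q.Prime) (hpq : p ≠ q)
    (hexp : ∀ x ∈ N, x ^ p = 1) {M : Subgroup G} [M.Normal] (hNM : N ≤ M)
    (hcent : ∀ m ∈ M, ∀ x ∈ N, x * m = m * x) (hrel : ¬ p ∣ N.relIndex M) (hM : ¬ q ∣ M.index) :
    IsPPrimeByQPrime p q G := by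
  have hcard : Nat.card (N.subgroupOf M) = Nat.card N :=
    Nat.card_congr (Subgroup.subgroupOfEquivOfLe hNM).toEquiv
  obtain ⟨H, hH⟩ := Subgroup.exists_right_complement'_of_coprime (N := N.subgroupOf M) (by
    rw [hcard]; exact coprime_card_of_exponent hp hexp hrel)
  have hHcard : Nat.card H = N.relIndex M := hH.symm.index_eq_card.symm
  have hdecomp : ∀ x ∈ M, ∃ n ∈ N, ∃ h : M, h ∈ H ∧ x = n * h := by
    intro x hx
    obtain ⟨⟨n, h⟩, hnh⟩ := hH.2 ⟨x, hx⟩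
    exact ⟨n, Subgroup.mem_subgroupOf.1 n.2, h, h.2, congrArg Subtype.val hnh.symm⟩
  have hdisj : ∀ n ∈ N, ∀ h : M, h ∈ H → n = h → n = 1 := by
    intro n hn h hh e
    have h1 : h ∈ N.subgroupOf M ⊓ H := ⟨Subgroup.mem_subgroupOf.2 (e ▸ hn), hh⟩
    rw [hH.disjoint.eq_bot, Subgroup.mem_bot] at h1
    rw [e, h1]; rfl
  -- Since N is central, the complement H given by Schur–Zassenhaus contains every element of M of
  -- order prime to p. This makes H invariant under conjugation by G.
  have hmem : ∀ x ∈ M, ∀ t : ℕ, Nat.Coprime p t → x ^ t = 1 → x ∈ H.map M.subtype := by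
    intro x hx t ht hxt
    obtain ⟨n, hn, h, hh, rfl⟩ := hdecomp x hx
    rw [(show Commute n (h : G) from hcent h h.2 n hn).mul_pow] at hxt
    have h1 : n ^ t = 1 := by
      refine hdisj _ (N.pow_mem hn t) (h⁻¹ ^ t) (H.pow_mem (H.inv_mem hh) t) ?_
      rw [eq_inv_of_mul_eq_one_left hxt]
      simp
    have h2 : n = 1 := eq_one_of_coprime_pow ht (hexp n hn) h1
    rw [h2, one_mul]
    exact ⟨h, hh, rfl⟩
  refine ⟨H.map M.subtype, ⟨?_⟩, ?_, ?_⟩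
  · rintro _ ⟨h, hh, rfl⟩ g
    refine hmem _ (Subgroup.Normal.conj_mem inferInstance _ h.2 g) (Nat.card H) ?_ ?_
    · rw [hHcard]; exact (hp.coprime_iff_not_dvd).2 hrel
    · have h1 := pow_card_eq_one' (x := (⟨h, hh⟩ : H))
      have h2 : (h : G) ^ Nat.card H = 1 := congrArg (fun z : H => ((z : M) : G)) h1
      rw [conj_pow, Subgroup.coe_subtype, h2]; simp
  · intro hd
    exact hrel (hHcard ▸ hd.trans (H.card_map_dvd _))
  · refine Subgroup.not_dvd_index_of_forall_mem hq ?_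
    rintro g ⟨k, hk⟩
    exact hmem g (Subgroup.mem_of_not_dvd_index (k := k) hq hM hk) (q ^ k)
      (Nat.Coprime.pow_right k ((Nat.coprime_primes hp hq).2 hpq)) hk

/-- Let L be the preimage of the normal p'-subgroup of G/N. If p ∤ |N|, take L. Otherwise L ∩ C(N)
has index prime to q: for soluble N it has N as a central Sylow p-subgroup, which is split off; for
nonsoluble N it meets N trivially and is itself a p'-group. -/
theorem IsMinimalNormal.isPPrimeByQPrime_of_quotient [Finite G] (hN : IsMinimalNormal N) [N.Normal]
    (hp : p.Prime) (hq : q.Prime) (hpq : p ≠ q) (hquot : IsPPrimeByQPrime p q (G ⧸ N))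
    (hC : p ∣ Nat.card N → ¬ q ∣ (Subgroup.centralizer (N : Set G)).index) :
    IsPPrimeByQPrime p q G := by
  obtain ⟨L', hL', hLp, hLq⟩ := hquot
  let f := QuotientGroup.mk' N
  have hf : Function.Surjective f := QuotientGroup.mk'_surjective N
  have hker : f.ker = N := QuotientGroup.ker_mk' N
  set L := L'.comap f with hL
  have hNL : N ≤ L := by rw [← hker]; exact Subgroup.ker_le_comap f L'
  have hLi : L.index = L'.index := L'.index_comap_of_surjective hf
  have hLr : ∀ M ≤ L, ¬ p ∣ N.relIndex M := by
    intro M hM hd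
    have h1 : N.relIndex M = Nat.card (M.map f) := by rw [← Subgroup.relIndex_ker, hker]
    rw [h1] at hd
    exact hLp (hd.trans (Subgroup.card_dvd_of_le (Subgroup.map_le_iff_le_comap.2 hM)))
  have hLn : L.Normal := hL'.comap f
  by_cases hpN : p ∣ Nat.card N
  · set C := Subgroup.centralizer (N : Set G) with hCdef
    have hMq : ¬ q ∣ (L ⊓ C).index := by
      refine Subgroup.not_dvd_index_of_forall_mem hq ?_
      rintro g ⟨k, hk⟩
      exact ⟨Subgroup.mem_of_not_dvd_index (k := k) hq (by rwa [hLi]) hk,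
        Subgroup.mem_of_not_dvd_index (k := k) hq (hC hpN) hk⟩
    by_cases hs : Group.IsSolvable N
    · obtain ⟨hcomm, hexp⟩ := hN.elementary_of_isSolvable hs hp hpN
      refine isPPrimeByQPrime_of_central hp hq hpq hexp (M := L ⊓ C) (le_inf hNL ?_) ?_
        (hLr _ inf_le_left) hMq
      · intro x hx
        exact Subgroup.mem_centralizer_iff.2 fun y hy => hcomm y hy x hx
      · intro m hm x hx
        exact Subgroup.mem_centralizer_iff.1 hm.2 x hx
    · refine ⟨L ⊓ C, inferInstance, ?_, hMq⟩
      have hbot : N ⊓ (L ⊓ C) = ⊥ := by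
        rcases hN.le_or_inf_eq_bot (M := L ⊓ C) inferInstance with h1 | h1
        · exfalso
          apply hs
          exact Group.isSolvable_of_comm fun x y => Subtype.ext
            (Subgroup.mem_centralizer_iff.1 (h1 y.2).2 x x.2)
        · exact h1
      have := hLr (L ⊓ C) inf_le_left
      rwa [← Subgroup.inf_relIndex_right, hbot, Subgroup.relIndex_bot_left] at this
  · refine ⟨L, hLn, ?_, by rwa [hLi]⟩
    intro hd
    have h1 : Nat.card N * N.relIndex L = Nat.card L := by
      rw [← Subgroup.relIndex_bot_left, ← Subgroup.relIndex_bot_left]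
      exact Subgroup.relIndex_mul_relIndex _ _ _ bot_le hNL
    rw [← h1] at hd
    rcases (hp.dvd_mul).1 hd with h2 | h2
    · exact hpN h2
    · exact hLr L le_rfl h2

end PrimeByPrime

theorem IsMinimalNormal.card_quotient_lt {G : Type*} [Group G] [Finite G] {N : Subgroup G}
    (hN : IsMinimalNormal N) : Nat.card (G ⧸ N) < Nat.card G := by
  rw [← N.card_mul_index]
  have h1 : 1 < Nat.card N := N.one_lt_card_iff_ne_bot.2 hN.ne_bot
  have h2 : 0 < N.index := Nat.pos_of_ne_zero Subgroup.index_ne_zero_of_finite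
  change N.index < _
  nlinarith

theorem isPPrimeByQPrime_of_mutuallyPermutable.{u} {p q : ℕ} (hp : p.Prime) (hq : q.Prime)
    (hpq : p ≠ q) : ∀ (n : ℕ) (G : Type u) [Group G] [Finite G] (A B : Subgroup G),
    Nat.card G = n → IsMutuallyPermutableProduct A B → NotLinked p q A B →
    IsPPrimeByQPrime p q A → IsPPrimeByQPrime p q B → IsPPrimeByQPrime p q G := by
  intro n
  induction n using Nat.strong_induction_on with
  | _ n ih =>
    intro G _ _ A B hn h hlink hA hB
    rcases subsingleton_or_nontrivial G with hG | hG
    · refine ⟨⊥, inferInstance, ?_, ?_⟩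
      · rw [Subgroup.card_bot]; exact hp.not_dvd_one
      · rw [Subgroup.index_bot, Nat.card_unique]; exact hq.not_dvd_one
    · obtain ⟨N, hN⟩ := exists_isMinimalNormal (G := G)
      have := hN.normal
      refine hN.isPPrimeByQPrime_of_quotient hp hq hpq ?_
        (fun hpN => h.not_dvd_index_centralizer hN hp hq hpq hlink hpN hA hB)
      exact ih _ (hn ▸ hN.card_quotient_lt) (G ⧸ N) _ _ rfl
        (h.map (QuotientGroup.mk' N) (QuotientGroup.mk'_surjective N)) (hlink.map _) (hA.map _) (hB.map _)

/-- Every `q`-element of `G` that normalises a `p`-subgroup of `G` centralises it. -/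
def QElementsCentralize (p q : ℕ) (G : Type*) [Group G] : Prop :=
  ∀ P : Subgroup G, IsPGroup p P → ∀ g : G, (∃ k : ℕ, g ^ q ^ k = 1) →
    (∀ x ∈ P, g * x * g⁻¹ ∈ P) → ∀ x ∈ P, g * x = x * g

/-! ### q-elements acting on p-subgroups (N-critical graph). -/

section QElementsCentralize

variable {G : Type*} [Group G] {A B N : Subgroup G} {p q : ℕ}

theorem QElementsCentralize.commute (h : QElementsCentralize p q A) {P : Subgroup G} (hPA : P ≤ A)
    (hP : IsPGroup p P) {g : G} (hg : g ∈ A) (hgq : ∃ k : ℕ, g ^ q ^ k = 1)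
    (hgP : ∀ x ∈ P, g * x * g⁻¹ ∈ P) : ∀ x ∈ P, g * x = x * g := by
  intro x hx
  obtain ⟨k, hk⟩ := hgq
  have hP' : IsPGroup p (P.subgroupOf A) := hP.of_equiv (Subgroup.subgroupOfEquivOfLe hPA).symm
  have := h _ hP' ⟨g, hg⟩ ⟨k, Subtype.ext hk⟩
    (fun y hy => Subgroup.mem_subgroupOf.2 (hgP y (Subgroup.mem_subgroupOf.1 hy))) ⟨x, hPA hx⟩
    (Subgroup.mem_subgroupOf.2 hx)
  exact congrArg Subtype.val this

theorem QElementsCentralize.subgroup (h : QElementsCentralize p q G) (H : Subgroup G) :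
    QElementsCentralize p q H := by
  rintro P hP g ⟨k, hk⟩ hgP x hx
  have := h (P.map H.subtype) (hP.map H.subtype) g ⟨k, congrArg Subtype.val hk⟩
    (by
      rintro _ ⟨y, hy, rfl⟩
      exact ⟨_, hgP y hy, rfl⟩) x ⟨x, hx, rfl⟩
  exact Subtype.ext this

theorem exists_pow_qElement [Finite G] {G' : Type*} [Group G'] (f : G →* G') (hq : q.Prime) {v : G}
    {k : ℕ} (hv : f v ^ q ^ k = 1) : ∃ t : ℕ, f (v ^ t) = f v ∧ ∃ a : ℕ, (v ^ t) ^ q ^ a = 1 := by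
  obtain ⟨a, m, hm, ham⟩ := Nat.exists_eq_pow_mul_and_not_dvd (orderOf_pos v).ne' q hq.ne_one
  have hco : Nat.Coprime (q ^ k) m := Nat.Coprime.pow_left k ((hq.coprime_iff_not_dvd).2 hm)
  -- t ≡ 1 mod q^k keeps the image of v; t ≡ 0 mod m, the q'-part of the order of v, makes v^t a
  -- q-element.
  obtain ⟨t, ht1, ht2⟩ := Nat.chineseRemainder hco 1 0
  refine ⟨t, ?_, a, ?_⟩
  · rw [map_pow]
    conv_rhs => rw [← pow_one (f v)]
    rw [pow_eq_pow_iff_modEq]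
    exact ht1.of_dvd (orderOf_dvd_of_pow_eq_one hv)
  · rw [← pow_mul, ← orderOf_dvd_iff_pow_eq_one, ham, mul_comm]
    exact mul_dvd_mul_right ((Nat.modEq_zero_iff_dvd).1 ht2) _

/-- A Sylow p-subgroup P₀ of the preimage of P' maps onto P'. By the Frattini argument g lifts to an
element normalising P₀, and a power of that lift is a q-element with the same image. -/
theorem QElementsCentralize.commute_of_surjective [Finite G] {G' : Type*} [Group G']
    (hp : p.Prime) (hq : q.Prime) (h : QElementsCentralize p q G) (f : G →* G')
    (hf : Function.Surjective f) {P' : Subgroup G'} (hPn : P'.Normal) (hP : IsPGroup p P') {g : G'}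
    (hg : ∃ k : ℕ, g ^ q ^ k = 1) : ∀ x ∈ P', g * x = x * g := by
  have := Fact.mk hp
  set H := P'.comap f with hH
  have hHn : H.Normal := hPn.comap f
  let P : Sylow p H := default
  set P₀ := (P : Subgroup H).map H.subtype with hP₀
  have hP₀p : IsPGroup p P₀ := P.isPGroup'.map H.subtype
  have hmap : ∀ x ∈ P', ∃ y ∈ P₀, f y = x := by
    have hs : Function.Surjective (f.subgroupComap P') := f.subgroupComap_surjective_of_surjective P' hf
    let Q := P.mapSurjective hs
    have hQ : (⊤ : Subgroup P') = Q := Q.is_maximal' (hP.to_subgroup ⊤) le_top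
    intro x hx
    have hxQ : (⟨x, hx⟩ : P') ∈ (Q : Subgroup P') := hQ ▸ Subgroup.mem_top _
    rw [Sylow.coe_mapSurjective] at hxQ
    obtain ⟨y, hy, e⟩ := hxQ
    exact ⟨y, ⟨y, hy, rfl⟩, congrArg Subtype.val e⟩
  have hfr : Subgroup.normalizer (P₀ : Set G) ⊔ H = ⊤ := P.normalizer_sup_eq_top
  obtain ⟨u, rfl⟩ := hf g
  have hu : u ∈ Subgroup.normalizer (P₀ : Set G) ⊔ H := hfr ▸ Subgroup.mem_top u
  obtain ⟨v, hv, w, hw, hvw⟩ := (SubgroupsPermute.of_normal_left H _).symm.mem_sup hu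
  obtain ⟨y, hy, hyw⟩ := hmap (f w) hw
  have hvy : v * y ∈ Subgroup.normalizer (P₀ : Set G) :=
    Subgroup.mul_mem _ hv (Subgroup.le_normalizer hy)
  have hfvy : f (v * y) = f u := by rw [map_mul, hyw, ← map_mul, hvw]
  obtain ⟨k, hk⟩ := hg
  obtain ⟨t, ht1, ht2⟩ := exists_pow_qElement f hq (v := v * y) (k := k) (by rw [hfvy, hk])
  have hc := h P₀ hP₀p _ ht2
    (fun x hx => Subgroup.normalizer_conj_mem (Subgroup.pow_mem _ hvy t) hx)
  intro x hx
  obtain ⟨z, hz, rfl⟩ := hmap x hx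
  rw [← hfvy, ← ht1, ← map_mul, ← map_mul, hc z hz]

theorem QElementsCentralize.of_surjective [Finite G] {G' : Type*} [Group G']
    (hp : p.Prime) (hq : q.Prime) (h : QElementsCentralize p q G) (f : G →* G')
    (hf : Function.Surjective f) : QElementsCentralize p q G' := by
  have : Finite G' := Finite.of_surjective f hf
  rintro P hP g ⟨k, hk⟩ hgP x hx
  set U := Subgroup.normalizer (P : Set G') with hU
  have hPU : P ≤ U := Subgroup.le_normalizer
  have hgU : g ∈ U := Subgroup.mem_normalizer_of_conj_mem hgP
  have hs : Function.Surjective (f.subgroupComap U) := f.subgroupComap_surjective_of_surjective U hf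
  have := (h.subgroup (U.comap f)).commute_of_surjective hp hq (f.subgroupComap U) hs
    (P' := P.subgroupOf U) inferInstance (hP.of_equiv (Subgroup.subgroupOfEquivOfLe hPU).symm)
    (g := ⟨g, hgU⟩) ⟨k, Subtype.ext hk⟩ ⟨x, hPU hx⟩ (Subgroup.mem_subgroupOf.2 hx)
  exact congrArg Subtype.val this

theorem QElementsCentralize.map [Finite G] {G' : Type*} [Group G'] (hp : p.Prime) (hq : q.Prime)
    (h : QElementsCentralize p q A) (f : G →* G') : QElementsCentralize p q (A.map f) :=
  h.of_surjective hp hq (f.subgroupMap A) (f.subgroupMap_surjective A)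

theorem permute_of_forall_exists_mul_eq (h : ∀ g : G, ∃ a ∈ A, ∃ b ∈ B, a * b = g) :
    SubgroupsPermute A B ∧ A ⊔ B = ⊤ := by
  refine ⟨SubgroupsPermute.of_forall fun k _ x _ => h _, ?_⟩
  rw [eq_top_iff]
  intro g _
  obtain ⟨a, ha, b, hb, rfl⟩ := h g
  exact Subgroup.mul_mem_sup ha hb

/-- A Frattini argument for a normal `p`-subgroup `P` and a normal subgroup `V`. -/
theorem commute_of_frattini [Finite G] (hp : p.Prime) (hq : q.Prime) {P Q V : Subgroup G}
    [P.Normal] [V.Normal] (hQ : IsPGroup p Q) (hQV : Q ≤ V)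
    (hV : ∀ g ∈ V, (∃ k : ℕ, g ^ q ^ k = 1) → ∀ x ∈ P, g * x = x * g)
    (hnorm : ∀ R ≤ V, Q ≤ R → IsPGroup p R → ∀ g : G, (∃ k : ℕ, g ^ q ^ k = 1) →
      (∀ x ∈ R, g * x * g⁻¹ ∈ R) → ∀ x ∈ P, g * x = x * g)
    {g : G} (hg : ∃ k : ℕ, g ^ q ^ k = 1) : ∀ x ∈ P, g * x = x * g := by
  have := Fact.mk hp
  have hQ' : IsPGroup p (Q.subgroupOf V) := hQ.of_equiv (Subgroup.subgroupOfEquivOfLe hQV).symm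
  obtain ⟨R, hR⟩ := hQ'.exists_le_sylow
  set R' := (R : Subgroup V).map V.subtype with hR'
  have hfr : Subgroup.normalizer (R' : Set G) ⊔ V = ⊤ := R.normalizer_sup_eq_top
  have hQR : Q ≤ R' := fun x hx => ⟨⟨x, hQV hx⟩, hR (Subgroup.mem_subgroupOf.2 hx), rfl⟩
  have hidx : ¬ q ∣ (Subgroup.centralizer (P : Set G)).index := by
    refine not_dvd_index_of_factors hq (SubgroupsPermute.of_normal_left V _) (by rwa [sup_comm]) ?_ ?_
    · intro g hg hgq
      exact Subgroup.mem_centralizer_iff.2 fun x hx => (hV g hg hgq x hx).symm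
    · intro g hg hgq
      exact Subgroup.mem_centralizer_iff.2 fun x hx =>
        (hnorm R' (Subgroup.map_subtype_le _) hQR (R.isPGroup'.map _) g hgq
          (fun y hy => Subgroup.normalizer_conj_mem hg hy) x hx).symm
  obtain ⟨k, hk⟩ := hg
  intro x hx
  exact (Subgroup.mem_centralizer_iff.1 (Subgroup.mem_of_not_dvd_index hq hidx hk) x hx).symm

theorem IsMutuallyPermutableProduct.commute_sylow [Finite G] (h : IsMutuallyPermutableProduct A B)
    [N.Normal] [Fact p.Prime] (hq : q.Prime)
    (hNA : N ≤ A ∨ ∀ a ∈ A, ∀ x ∈ N, a * x = x * a)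
    (hNB : N ≤ B ∨ ∀ b ∈ B, ∀ x ∈ N, b * x = x * b)
    (hA : QElementsCentralize p q A) (hB : QElementsCentralize p q B) (S : Sylow p N) {g : G}
    (hg : ∃ k : ℕ, g ^ q ^ k = 1)
    (hgS : ∀ x ∈ (S : Subgroup N).map N.subtype, g * x * g⁻¹ ∈ (S : Subgroup N).map N.subtype) :
    ∀ x ∈ (S : Subgroup N).map N.subtype, g * x = x * g := by
  set P := (S : Subgroup N).map N.subtype with hP
  have hPp : IsPGroup p P := S.isPGroup'.map N.subtype
  have hPN : P ≤ N := Subgroup.map_subtype_le _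
  set U := Subgroup.normalizer (P : Set G) with hU
  have hPU : P ≤ U := Subgroup.le_normalizer
  have hfr : ∀ x : G, ∃ n ∈ N, ∃ v ∈ U, n * v = x := by
    intro x
    have hx : x ∈ N ⊔ U := by
      have : U ⊔ N = ⊤ := S.normalizer_sup_eq_top
      rw [sup_comm, this]; trivial
    exact (SubgroupsPermute.of_normal_left N U).mem_sup hx
  -- The normaliser U inherits the factorisation. If both factors contain N, Frattini gives b = nv
  -- with n ∈ N and v ∈ U ∩ B, and n is moved into A. If one factor centralises N, its elements lie
  -- in U already.
  have hdecomp : ∀ x ∈ U, ∃ a ∈ A, ∃ b ∈ B, a ∈ U ∧ b ∈ U ∧ a * b = x := by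
    intro x hx
    obtain ⟨a, ha, b, hb, hab⟩ := h.exists_mul_eq x
    rcases hNA with hNA | hNA
    · rcases hNB with hNB | hNB
      · obtain ⟨n, hn, v, hv, rfl⟩ := hfr b
        have hvB : v ∈ B := by simpa using B.mul_mem (B.inv_mem (hNB hn)) hb
        refine ⟨a * n, A.mul_mem ha (hNA hn), v, hvB, ?_, hv, by rw [← hab]; group⟩
        have : a * n = x * v⁻¹ := by rw [← hab]; group
        rw [this]
        exact U.mul_mem hx (U.inv_mem hv)
      · have hbU : b ∈ U := Subgroup.mem_normalizer_of_conj_mem fun y hy => by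
          rwa [hNB b hb y (hPN hy), mul_inv_cancel_right]
        refine ⟨a, ha, b, hb, ?_, hbU, hab⟩
        have : a = x * b⁻¹ := by rw [← hab]; group
        rw [this]
        exact U.mul_mem hx (U.inv_mem hbU)
    · have haU : a ∈ U := Subgroup.mem_normalizer_of_conj_mem fun y hy => by
        rwa [hNA a ha y (hPN hy), mul_inv_cancel_right]
      refine ⟨a, ha, b, hb, haU, ?_, hab⟩
      have : b = a⁻¹ * x := by rw [← hab]; group
      rw [this]
      exact U.mul_mem (U.inv_mem haU) hx
  have key : ∀ D : Subgroup G, (N ≤ D ∨ ∀ d ∈ D, ∀ x ∈ N, d * x = x * d) →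
      QElementsCentralize p q D → ∀ u : U, u ∈ D.subgroupOf U → (∃ k : ℕ, u ^ q ^ k = 1) →
      u ∈ (Subgroup.centralizer (P : Set G)).subgroupOf U := by
    rintro D hND hD ⟨u, hu⟩ huD ⟨k, hk⟩
    have huD' : u ∈ D := Subgroup.mem_subgroupOf.1 huD
    refine Subgroup.mem_subgroupOf.2 (Subgroup.mem_centralizer_iff.2 fun x hx => ?_)
    rcases hND with hND | hND
    · exact (hD.commute (hPN.trans hND) hPp huD' ⟨k, congrArg Subtype.val hk⟩
        (fun y hy => Subgroup.normalizer_conj_mem hu hy) x hx).symm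
    · exact (hND u huD' x (hPN hx)).symm
  obtain ⟨hperm, htop⟩ := permute_of_forall_exists_mul_eq (A := A.subgroupOf U) (B := B.subgroupOf U) (by
    rintro ⟨x, hx⟩
    obtain ⟨a, ha, b, hb, haU, hbU, e⟩ := hdecomp x hx
    exact ⟨⟨a, haU⟩, Subgroup.mem_subgroupOf.2 ha, ⟨b, hbU⟩, Subgroup.mem_subgroupOf.2 hb,
      Subtype.ext e⟩)
  have hidx := not_dvd_index_of_factors (C := (Subgroup.centralizer (P : Set G)).subgroupOf U) hq
    hperm htop (key A hNA hA) (key B hNB hB)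
  obtain ⟨k, hk⟩ := hg
  have hgU : g ∈ U := Subgroup.mem_normalizer_of_conj_mem hgS
  have hgC := Subgroup.mem_of_not_dvd_index hq hidx (g := (⟨g, hgU⟩ : U)) (k := k) (Subtype.ext hk)
  intro x hx
  exact (Subgroup.mem_centralizer_iff.1 (Subgroup.mem_subgroupOf.1 hgC) x hx).symm

/-- If `q`-elements act trivially on the Sylow `p`-subgroups of the normal subgroup `N` that they
normalise, and `N` has the same property for all its `p`-subgroups, then `q`-elements of `G` act
trivially on all `p`-subgroups of `N` that they normalise. -/
theorem commute_of_le_of_sylow [Finite G] [N.Normal] [Fact p.Prime] (hq : q.Prime)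
    (hN : QElementsCentralize p q N)
    (hS : ∀ (S : Sylow p N) (g : G), (∃ k : ℕ, g ^ q ^ k = 1) →
      (∀ x ∈ (S : Subgroup N).map N.subtype, g * x * g⁻¹ ∈ (S : Subgroup N).map N.subtype) →
      ∀ x ∈ (S : Subgroup N).map N.subtype, g * x = x * g) :
    ∀ (n : ℕ) (P : Subgroup G), P ≤ N → IsPGroup p P → Nat.card G - Nat.card P = n → ∀ g : G,
      (∃ k : ℕ, g ^ q ^ k = 1) → (∀ x ∈ P, g * x * g⁻¹ ∈ P) → ∀ x ∈ P, g * x = x * g := by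
  intro n
  induction n using Nat.strong_induction_on with
  | _ n ih =>
    intro P hPN hP hn g hg hgP
    obtain ⟨S, hPS⟩ := (hP.of_equiv (Subgroup.subgroupOfEquivOfLe hPN).symm).exists_le_sylow
    set T := (S : Subgroup N).map N.subtype with hT
    have hTp : IsPGroup p T := S.isPGroup'.map N.subtype
    have hPT : P ≤ T := fun x hx => ⟨⟨x, hPN hx⟩, hPS (Subgroup.mem_subgroupOf.2 hx), rfl⟩
    have hTN : T ≤ N := Subgroup.map_subtype_le _
    by_cases hPeq : P = T
    · rw [hPeq] at hgP ⊢
      exact hS S g hg hgP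
    have hlt : P.subgroupOf T < ⊤ := by
      rw [lt_top_iff_ne_top]
      intro e
      exact hPeq (le_antisymm hPT (Subgroup.subgroupOf_eq_top.1 e))
    -- Normalisers grow in the p-group T, so T ∩ U properly contains P. Every p-subgroup R of U
    -- above T ∩ U is then larger than P, and the induction hypothesis applies to it.
    have hnil : Group.IsNilpotent T := hTp.isNilpotent
    have hgrow := Group.normalizerCondition_of_isNilpotent (G := T) _ hlt
    obtain ⟨s, hs, hsP⟩ := SetLike.exists_of_lt hgrow
    set U := Subgroup.normalizer (P : Set G) with hU
    have hPU : P ≤ U := Subgroup.le_normalizer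
    have hsU : (s : G) ∈ U := by
      refine Subgroup.mem_normalizer_of_conj_mem fun x hx => ?_
      exact Subgroup.mem_subgroupOf.1 (Subgroup.normalizer_conj_mem hs
        (x := ⟨x, hPT hx⟩) (Subgroup.mem_subgroupOf.2 hx))
    have hQp : IsPGroup p ((T ⊓ U).subgroupOf U) :=
      (hTp.to_le inf_le_left).of_equiv (Subgroup.subgroupOfEquivOfLe inf_le_right).symm
    intro x hx
    have hgU : g ∈ U := Subgroup.mem_normalizer_of_conj_mem hgP
    obtain ⟨k, hk⟩ := hg
    have := commute_of_frattini (G := U) (P := P.subgroupOf U) (Q := (T ⊓ U).subgroupOf U)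
      (V := N.subgroupOf U) (p := p) (q := q) (Fact.out) hq hQp ?_ ?_ ?_ (g := ⟨g, hgU⟩)
      ⟨k, Subtype.ext hk⟩ ⟨x, hPU hx⟩ (Subgroup.mem_subgroupOf.2 hx)
    · exact congrArg Subtype.val this
    · intro y hy
      exact Subgroup.mem_subgroupOf.2 (hTN (Subgroup.mem_subgroupOf.1 hy).1)
    · rintro ⟨u, hu⟩ huN ⟨l, hl⟩ ⟨y, hyU⟩ hy
      exact Subtype.ext (hN.commute hPN hP (Subgroup.mem_subgroupOf.1 huN)
        ⟨l, congrArg Subtype.val hl⟩ (fun z hz => Subgroup.normalizer_conj_mem hu hz) y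
        (Subgroup.mem_subgroupOf.1 hy))
    · rintro R hRN hQR hR ⟨u, hu⟩ ⟨l, hl⟩ huR ⟨y, hyU⟩ hy
      have hyP : y ∈ P := Subgroup.mem_subgroupOf.1 hy
      have hTUR : T ⊓ U ≤ R.map U.subtype := fun z hz =>
        ⟨⟨z, hz.2⟩, hQR (Subgroup.mem_subgroupOf.2 hz), rfl⟩
      have hPR : P ≤ R.map U.subtype := (le_inf hPT hPU).trans hTUR
      have hcard : Nat.card P < Nat.card (R.map U.subtype) := by
        by_contra hc
        have e := Subgroup.eq_of_le_of_card_ge hPR (not_lt.1 hc)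
        apply hsP
        rw [Subgroup.mem_subgroupOf, e]
        exact hTUR ⟨s.2, hsU⟩
      have hle : Nat.card (R.map U.subtype) ≤ Nat.card G := Subgroup.card_le_card_group _
      refine Subtype.ext (ih _ ?_ (R.map U.subtype) ?_ (hR.map _) rfl u ⟨l, congrArg Subtype.val hl⟩ ?_
        y (hPR hyP))
      · omega
      · rintro _ ⟨z, hz, rfl⟩
        exact Subgroup.mem_subgroupOf.1 (hRN hz)
      · rintro _ ⟨z, hz, rfl⟩
        exact ⟨_, huR z hz, rfl⟩

/-- By the quotient, g moves x ∈ P only by an element of N ∩ P, and by the hypothesis on N it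
centralises that subgroup; coprimality does the rest. -/
theorem QElementsCentralize.of_quotient [Finite G] [N.Normal] (hp : p.Prime) (hq : q.Prime) (hpq : p ≠ q)
    (hquot : QElementsCentralize p q (G ⧸ N))
    (hN : ∀ P ≤ N, IsPGroup p P → ∀ g : G, (∃ k : ℕ, g ^ q ^ k = 1) →
      (∀ x ∈ P, g * x * g⁻¹ ∈ P) → ∀ x ∈ P, g * x = x * g) : QElementsCentralize p q G := by
  rintro P hP g ⟨k, hk⟩ hgP x hx
  have h1 := hquot (P.map (QuotientGroup.mk' N)) (hP.map _) (g : G ⧸ N)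
    ⟨k, by rw [← QuotientGroup.mk_pow, hk, QuotientGroup.mk_one]⟩
    (by
      rintro _ ⟨y, hy, rfl⟩
      exact ⟨_, hgP y hy, rfl⟩) (x : G ⧸ N) ⟨x, hx, rfl⟩
  have heN : g * x * g⁻¹ * x⁻¹ ∈ N := by
    rw [← QuotientGroup.eq_one_iff, QuotientGroup.mk_mul, QuotientGroup.mk_mul, QuotientGroup.mk_mul,
      h1, QuotientGroup.mk_inv, QuotientGroup.mk_inv]
    group
  have heP : g * x * g⁻¹ * x⁻¹ ∈ P := P.mul_mem (hgP x hx) (P.inv_mem hx)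
  obtain ⟨l, hl⟩ := hP ⟨_, heP⟩
  refine commute_of_conj_eq_mul (l := l) hp hq hpq hk (congrArg Subtype.val hl) ?_ (n := x) (by group)
  exact hN (N ⊓ P) inf_le_left (hP.to_le inf_le_right) g ⟨k, hk⟩
    (fun y hy => ⟨Subgroup.Normal.conj_mem inferInstance y hy.1 g, hgP y hy.2⟩) _ ⟨heN, heP⟩

theorem IsMutuallyPermutableProduct.commute_of_le_minimalNormal [Finite G]
    (h : IsMutuallyPermutableProduct A B) (hN : IsMinimalNormal N) (hp : p.Prime) (hq : q.Prime)
    (hpq : p ≠ q) (hlink : NotLinked p q A B)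
    (hA : QElementsCentralize p q A) (hB : QElementsCentralize p q B) {P : Subgroup G} (hPN : P ≤ N)
    (hP : IsPGroup p P) {g : G} (hg : ∃ k : ℕ, g ^ q ^ k = 1) (hgP : ∀ x ∈ P, g * x * g⁻¹ ∈ P) :
    ∀ x ∈ P, g * x = x * g := by
  have := Fact.mk hp
  have := hN.normal
  by_cases hs : Group.IsSolvable N
  · by_cases hpN : p ∣ Nat.card N
    · obtain ⟨hcomm, hexp⟩ := hN.elementary_of_isSolvable hs hp hpN
      have hfac : ∀ D : Subgroup G, QElementsCentralize p q D → ∀ g ∈ D, (∃ k : ℕ, g ^ q ^ k = 1) →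
          ∀ x ∈ N ⊓ D, g * x = x * g := by
        intro D hD g hg hgq
        refine hD.commute inf_le_right ?_ hg hgq ?_
        · rintro ⟨x, hx⟩
          exact ⟨1, Subtype.ext (by rw [pow_one]; exact hexp x hx.1)⟩
        · exact fun x hx => ⟨hN.normal.conj_mem x hx.1 g, D.mul_mem (D.mul_mem hg hx.2) (D.inv_mem hg)⟩
      have hidx := h.commute_of_elementary hN hp hq hpq hlink hcomm hexp (hfac A hA) (hfac B hB)
      obtain ⟨k, hk⟩ := hg
      intro x hx
      exact (Subgroup.mem_centralizer_iff.1 (Subgroup.mem_of_not_dvd_index hq hidx hk) x (hPN hx)).symm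
    · intro x hx
      obtain ⟨l, hl⟩ := hP ⟨x, hx⟩
      rw [eq_one_of_not_dvd_card (k := l) hp hpN (hPN hx) (congrArg Subtype.val hl)]
      simp
  · have hNA := h.le_or_commute_of_not_isSolvable hN hs
    have hNB := h.symm.le_or_commute_of_not_isSolvable hN hs
    have hNq : QElementsCentralize p q N := by
      have key : ∀ D : Subgroup G, N ≤ D → QElementsCentralize p q D → QElementsCentralize p q N := by
        intro D hND hD R hR g ⟨k, hk⟩ hgR x hx
        refine Subtype.ext (hD.commute (P := R.map N.subtype)
          ((Subgroup.map_subtype_le R).trans hND) (hR.map _) (hND g.2)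
          ⟨k, congrArg Subtype.val hk⟩ ?_ x ⟨x, hx, rfl⟩)
        rintro _ ⟨y, hy, rfl⟩
        exact ⟨_, hgR y hy, rfl⟩
      rcases h.le_or_le_of_not_isSolvable hN hs with h1 | h1
      · exact key A h1 hA
      · exact key B h1 hB
    exact commute_of_le_of_sylow hq hNq
      (fun S g hg hgS => h.commute_sylow hq hNA hNB hA hB S hg hgS) _ P hPN hP rfl g hg hgP

end QElementsCentralize

theorem qElementsCentralize_of_mutuallyPermutable.{u} {p q : ℕ} (hp : p.Prime) (hq : q.Prime)
    (hpq : p ≠ q) : ∀ (n : ℕ) (G : Type u) [Group G] [Finite G] (A B : Subgroup G),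
    Nat.card G = n → IsMutuallyPermutableProduct A B → NotLinked p q A B →
    QElementsCentralize p q A → QElementsCentralize p q B → QElementsCentralize p q G := by
  intro n
  induction n using Nat.strong_induction_on with
  | _ n ih =>
    intro G _ _ A B hn h hlink hA hB
    rcases subsingleton_or_nontrivial G with hG | hG
    · intro P _ g _ _ x _
      exact Subsingleton.elim _ _
    · obtain ⟨N, hN⟩ := exists_isMinimalNormal (G := G)
      have := hN.normal
      refine QElementsCentralize.of_quotient (N := N) hp hq hpq ?_
        (fun P hPN hP g hg hgP => h.commute_of_le_minimalNormal hN hp hq hpq hlink hA hB hPN hP hg hgP)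
      exact ih _ (hn ▸ hN.card_quotient_lt) (G ⧸ N) _ _ rfl
        (h.map (QuotientGroup.mk' N) (QuotientGroup.mk'_surjective N)) (hlink.map _)
        (hA.map hp hq _) (hB.map hp hq _)

/-! ### The subgroups O_π(G) and O_{p',p}(G). -/

section Cores

theorem mem_primeDivisors {G : Type*} [Finite G] [Nonempty G] {r : ℕ} :
    r ∈ primeDivisors G ↔ r.Prime ∧ r ∣ Nat.card G := by
  change r ∈ (Nat.card G).primeFactors ↔ _
  rw [Nat.mem_primeFactors]
  exact ⟨fun h => ⟨h.1, h.2.1⟩, fun h => ⟨h.1, h.2, Nat.card_pos.ne'⟩⟩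

theorem isPGroup_of_primeDivisors_subset {G : Type*} [Group G] [Finite G] {p : ℕ}
    (h : primeDivisors G ⊆ {p}) : IsPGroup p G :=
  IsPGroup.of_card (Nat.eq_prime_pow_of_unique_prime_dvd Nat.card_pos.ne'
    fun {_} hd hdvd => h (mem_primeDivisors.2 ⟨hd, hdvd⟩))

theorem primeDivisors_subset_of_isPGroup {G : Type*} [Group G] [Finite G] {p : ℕ} (hp : p.Prime)
    (h : IsPGroup p G) : primeDivisors G ⊆ {p} := by
  have := Fact.mk hp
  intro r hr
  obtain ⟨hr, hd⟩ := mem_primeDivisors.1 hr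
  obtain ⟨n, hn⟩ := IsPGroup.iff_card.1 h
  rw [hn] at hd
  exact (Nat.prime_dvd_prime_iff_eq hr hp).1 (hr.dvd_of_dvd_pow hd)

theorem opPrimeCore_le_opPrimePCore {G : Type*} [Group G] {p : ℕ} :
    opPrimeCore p G ≤ opPrimePCore p G := by
  have := Subgroup.ker_le_comap (QuotientGroup.mk' (opPrimeCore p G)) (opCore p (G ⧸ opPrimeCore p G))
  rwa [QuotientGroup.ker_mk'] at this

variable {G : Type*} [Group G] [Finite G] {p q : ℕ}

theorem isPiGroup_piCore (π : Set ℕ) : IsPiGroup π (piCore π G) := by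
  let S : Set (Subgroup G) := {N | N.Normal ∧ IsPiGroup π N}
  have hbot : (⊥ : Subgroup G) ∈ S := by
    refine ⟨inferInstance, fun r hr => ?_⟩
    have := (mem_primeDivisors.1 hr)
    rw [Subgroup.card_bot] at this
    exact absurd this.2 this.1.not_dvd_one
  obtain ⟨M, hM⟩ := (Set.toFinite S).exists_maximal ⟨⊥, hbot⟩
  obtain ⟨hMn, hMp⟩ := hM.prop
  have hle : piCore π G ≤ M := by
    refine sSup_le fun N hN => ?_
    have hNn : N.Normal := hN.1
    refine le_sup_right.trans (hM.le_of_ge (show M ⊔ N ∈ S from ⟨inferInstance, ?_⟩) le_sup_left)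
    intro r hr
    obtain ⟨hrp, hrd⟩ := mem_primeDivisors.1 hr
    rcases (hrp.dvd_mul).1 (hrd.trans (SubgroupsPermute.of_normal_left M N).card_sup_dvd) with h | h
    · exact hMp (mem_primeDivisors.2 ⟨hrp, h⟩)
    · exact hN.2 (mem_primeDivisors.2 ⟨hrp, h⟩)
  rw [le_antisymm hle (le_sSup ⟨hMn, hMp⟩)]
  exact hMp

theorem not_dvd_card_opPrimeCore (hp : p.Prime) : ¬ p ∣ Nat.card (opPrimeCore p G) := fun h =>
  (isPiGroup_piCore (G := G) {r | r.Prime ∧ r ≠ p} (mem_primeDivisors.2 ⟨hp, h⟩)).2 rfl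

theorem le_opPrimeCore {K : Subgroup G} (hK : K.Normal) (hp : ¬ p ∣ Nat.card K) :
    K ≤ opPrimeCore p G := by
  refine le_sSup ⟨hK, fun r hr => ?_⟩
  obtain ⟨hrp, hrd⟩ := mem_primeDivisors.1 hr
  exact ⟨hrp, fun e => hp (e ▸ hrd)⟩

theorem exists_pow_mem_opPrimeCore {x : G} (hx : x ∈ opPrimePCore p G) :
    ∃ k : ℕ, x ^ p ^ k ∈ opPrimeCore p G := by
  have hP : IsPGroup p (opCore p (G ⧸ opPrimeCore p G)) :=
    isPGroup_of_primeDivisors_subset (isPiGroup_piCore _)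
  obtain ⟨k, hk⟩ := hP ⟨_, hx⟩
  refine ⟨k, ?_⟩
  rw [← QuotientGroup.eq_one_iff, QuotientGroup.mk_pow]
  exact congrArg Subtype.val hk

theorem le_opPrimePCore (hp : p.Prime) {M : Subgroup G} (hM : M.Normal)
    (h : ∀ x ∈ M, ∃ k : ℕ, x ^ p ^ k ∈ opPrimeCore p G) : M ≤ opPrimePCore p G := by
  change M ≤ (opCore p (G ⧸ opPrimeCore p G)).comap (QuotientGroup.mk' (opPrimeCore p G))
  rw [← Subgroup.map_le_iff_le_comap]
  refine le_sSup ⟨hM.map _ (QuotientGroup.mk'_surjective _), primeDivisors_subset_of_isPGroup hp ?_⟩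
  rintro ⟨_, x, hx, rfl⟩
  obtain ⟨k, hk⟩ := h x hx
  refine ⟨k, Subtype.ext ?_⟩
  change ((x ^ p ^ k : G) : G ⧸ opPrimeCore p G) = 1
  exact (QuotientGroup.eq_one_iff _).2 hk

/-- An element of the intersection has a p-power in O_{p'}(G) ∩ H, which lies in O_{p'}(H). -/
theorem subgroupOf_opPrimePCore_le (hp : p.Prime) (H : Subgroup G) :
    (opPrimePCore p G).subgroupOf H ≤ opPrimePCore p H := by
  refine le_opPrimePCore hp inferInstance fun x hx => ?_
  obtain ⟨k, hk⟩ := exists_pow_mem_opPrimeCore (Subgroup.mem_subgroupOf.1 hx)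
  refine ⟨k, le_opPrimeCore (K := (opPrimeCore p G).subgroupOf H) inferInstance ?_
    (Subgroup.mem_subgroupOf.2 hk)⟩
  intro hd
  refine not_dvd_card_opPrimeCore (G := G) hp (hd.trans ?_)
  rw [← Subgroup.card_map_of_injective (K := (opPrimeCore p G).subgroupOf H) H.subtype_injective,
    Subgroup.subgroupOf_map_subtype]
  exact Subgroup.card_dvd_of_le inf_le_left

theorem index_opPrimePCore_subgroup_dvd (hp : p.Prime) (H : Subgroup G) :
    (opPrimePCore p H).index ∣ (opPrimePCore p G).index :=
  (Subgroup.index_dvd_of_le (subgroupOf_opPrimePCore_le hp H)).trans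
    (Subgroup.relIndex_dvd_index_of_normal _ _)

/-- O_{p',p}(G)/O_{p'}(G) is a p-group, so q-elements of O_{p',p}(G) already lie in O_{p'}(G). This
needs p ≠ q, and so loops are treated apart. -/
theorem dvd_index_opPrimePCore_iff (hp : p.Prime) (hq : q.Prime) (hpq : p ≠ q) :
    q ∣ (opPrimePCore p G).index ↔ ¬ IsPPrimeByQPrime p q G := by
  constructor
  · rintro h ⟨K, hK, hKp, hKq⟩
    exact hKq (h.trans (Subgroup.index_dvd_of_le
      ((le_opPrimeCore hK hKp).trans opPrimeCore_le_opPrimePCore)))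
  · intro h
    by_contra hd
    refine h ⟨opPrimeCore p G, inferInstance, not_dvd_card_opPrimeCore hp, ?_⟩
    refine Subgroup.not_dvd_index_of_forall_mem hq ?_
    rintro g ⟨k, hk⟩
    obtain ⟨l, hl⟩ := exists_pow_mem_opPrimeCore (Subgroup.mem_of_not_dvd_index hq hd hk)
    rw [← QuotientGroup.eq_one_iff]
    refine eq_one_of_coprime_pow (m := p ^ l) (n := q ^ k)
      (Nat.Coprime.pow _ _ ((Nat.coprime_primes hp hq).2 hpq)) ?_ ?_
    · rw [← QuotientGroup.mk_pow, QuotientGroup.eq_one_iff]; exact hl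
    · rw [← QuotientGroup.mk_pow, hk, QuotientGroup.mk_one]

end Cores

/-! ### Schmidt subgroups and the action of q-elements. -/

section Schmidt

variable {p q : ℕ}

theorem IsSchmidtPQGroup.prime_and_ne {S : Type*} [Group S] [Finite S] (h : IsSchmidtPQGroup p q S) :
    p.Prime ∧ q.Prime ∧ p ≠ q := by
  obtain ⟨⟨hn, -⟩, hpi, -⟩ := h
  have h1 : p ∈ primeDivisors S := by rw [hpi]; simp
  have h2 : q ∈ primeDivisors S := by rw [hpi]; simp
  refine ⟨(mem_primeDivisors.1 h1).1, (mem_primeDivisors.1 h2).1, ?_⟩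
  rintro rfl
  have := Fact.mk (mem_primeDivisors.1 h1).1
  exact hn (isPGroup_of_primeDivisors_subset (p := p) (by rw [hpi]; simp)).isNilpotent

/-- If q-elements centralised the normal Sylow p-subgroup P, then P would normalise each Sylow
q-subgroup; all Sylow subgroups would be normal and S nilpotent. -/
theorem IsSchmidtPQGroup.not_qElementsCentralize {S : Type*} [Group S] [Finite S]
    (h : IsSchmidtPQGroup p q S) : ¬ QElementsCentralize p q S := by
  intro hS
  obtain ⟨hp, hq, hpq⟩ := h.prime_and_ne
  obtain ⟨⟨hn, -⟩, hpi, P, hP⟩ := h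
  have := Fact.mk hp
  have := Fact.mk hq
  apply hn
  refine ((Group.isNilpotent_of_finite_tfae (G := S)).out 0 3).2 ?_
  intro r hr R
  by_cases hrp : r = p
  · subst hrp
    have : Subsingleton (Sylow r S) := (Sylow.unique_of_normal P hP).instSubsingleton
    rw [Subsingleton.elim R P]
    exact hP
  by_cases hrq : r = q
  · subst hrq
    rw [← Subgroup.normalizer_eq_top_iff, ← Subgroup.index_eq_one]
    have hPR : (P : Subgroup S) ≤ Subgroup.normalizer ((R : Subgroup S) : Set S) := by
      intro x hx
      refine Subgroup.mem_normalizer_of_conj_mem fun g hg => ?_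
      obtain ⟨k, hk⟩ := R.isPGroup' ⟨g, hg⟩
      have := hS P P.isPGroup' g ⟨k, congrArg Subtype.val hk⟩
        (fun y hy => hP.conj_mem y hy g) x hx
      rw [← this, mul_inv_cancel_right]
      exact hg
    by_contra hne
    obtain ⟨s, hs, hsd⟩ := Nat.exists_prime_and_dvd hne
    have hsS : s ∈ primeDivisors S := mem_primeDivisors.2 ⟨hs, hsd.trans (Subgroup.index_dvd_card _)⟩
    rw [hpi] at hsS
    rcases hsS with rfl | rfl
    · exact P.not_dvd_index (hsd.trans (Subgroup.index_dvd_of_le hPR))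
    · exact R.not_dvd_index (hsd.trans (Subgroup.index_dvd_of_le Subgroup.le_normalizer))
  · have hbot : (R : Subgroup S) = ⊥ := by
      rw [← Subgroup.card_eq_one]
      by_contra hne
      obtain ⟨s, hs, hsd⟩ := Nat.exists_prime_and_dvd hne
      have hsr : s = r := primeDivisors_subset_of_isPGroup hr.out R.isPGroup'
        (mem_primeDivisors.2 ⟨hs, hsd⟩)
      have hsS : s ∈ primeDivisors S :=
        mem_primeDivisors.2 ⟨hs, hsd.trans (Subgroup.card_subgroup_dvd_card _)⟩
      rw [hpi] at hsS
      rcases hsS with h1 | h1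
      · exact hrp (hsr.symm.trans h1)
      · exact hrq (hsr.symm.trans h1)
    rw [hbot]
    infer_instance

theorem isPGroup_zpowers {G : Type*} [Group G] {g : G} {k : ℕ} (hg : g ^ q ^ k = 1) :
    IsPGroup q (Subgroup.zpowers g) := by
  rintro ⟨_, i, rfl⟩
  refine ⟨k, Subtype.ext ?_⟩
  change (g ^ i) ^ q ^ k = 1
  rw [← zpow_natCast, ← zpow_mul, mul_comm, zpow_mul, zpow_natCast, hg, one_zpow]

variable {G : Type*} [Group G] [Finite G]

theorem not_isNilpotent_sup_zpowers (hp : p.Prime) (hq : q.Prime) (hpq : p ≠ q) {P : Subgroup G}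
    (hP : IsPGroup p P) {g : G} {k : ℕ} (hg : g ^ q ^ k = 1) {x : G} (hx : x ∈ P)
    (hgx : g * x ≠ x * g) : ¬ Group.IsNilpotent (P ⊔ Subgroup.zpowers g : Subgroup G) := by
  intro hnil
  have := Fact.mk hp
  have := Fact.mk hq
  set W := P ⊔ Subgroup.zpowers g with hW
  have hPW : P ≤ W := le_sup_left
  have hgW : Subgroup.zpowers g ≤ W := le_sup_right
  obtain ⟨R, hR⟩ := (hP.of_equiv (Subgroup.subgroupOfEquivOfLe hPW).symm).exists_le_sylow
  obtain ⟨Q, hQ⟩ :=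
    ((isPGroup_zpowers hg).of_equiv (Subgroup.subgroupOfEquivOfLe hgW).symm).exists_le_sylow
  have hdisj := IsPGroup.disjoint_of_ne p q hpq _ _ R.isPGroup' Q.isPGroup'
  have := Subgroup.commute_of_normal_of_disjoint (R : Subgroup W) (Q : Subgroup W) inferInstance
    inferInstance hdisj ⟨x, hPW hx⟩ ⟨g, hgW (Subgroup.mem_zpowers g)⟩
    (hR (Subgroup.mem_subgroupOf.2 hx)) (hQ (Subgroup.mem_subgroupOf.2 (Subgroup.mem_zpowers g)))
  exact hgx (congrArg Subtype.val this).symm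

theorem exists_isSchmidtGroup_le {W : Subgroup G} (hW : ¬ Group.IsNilpotent W) :
    ∃ S ≤ W, IsSchmidtGroup S := by
  obtain ⟨S, hSW, hS⟩ := (Set.toFinite {K : Subgroup G | ¬ Group.IsNilpotent K}).exists_le_minimal
    (show W ∈ {K : Subgroup G | ¬ Group.IsNilpotent K} from hW)
  refine ⟨S, hSW, hS.prop, fun H hH => ?_⟩
  by_contra hn
  apply hH
  have h1 : ¬ Group.IsNilpotent (H.map S.subtype) := fun h2 =>
    hn (Group.nilpotent_of_mulEquiv (H.equivMapOfInjective S.subtype S.subtype_injective).symm)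
  have h3 := hS.le_of_le h1 (Subgroup.map_subtype_le H)
  rw [eq_top_iff]
  intro y _
  obtain ⟨z, hz, e⟩ := h3 y.2
  exact (Subtype.ext e : z = y) ▸ hz

/-- Conversely, if g normalises but does not centralise P, then P⟨g⟩ is not nilpotent. A minimal
non-nilpotent subgroup S of it involves both primes and has P ∩ S as normal Sylow p-subgroup. -/
theorem exists_isSchmidtPQGroup_iff :
    (∃ S : Subgroup G, IsSchmidtPQGroup p q S) ↔
      p.Prime ∧ q.Prime ∧ p ≠ q ∧ ¬ QElementsCentralize p q G := by
  constructor
  · rintro ⟨S, hS⟩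
    obtain ⟨hp, hq, hpq⟩ := hS.prime_and_ne
    exact ⟨hp, hq, hpq, fun h => hS.not_qElementsCentralize (h.subgroup S)⟩
  · rintro ⟨hp, hq, hpq, h⟩
    unfold QElementsCentralize at h
    push Not at h
    obtain ⟨P, hP, g, ⟨k, hk⟩, hgP, x, hx, hgx⟩ := h
    have := Fact.mk hp
    have := Fact.mk hq
    obtain ⟨S, hSW, hS⟩ :=
      exists_isSchmidtGroup_le (not_isNilpotent_sup_zpowers hp hq hpq hP hk hx hgx)
    have hZ := isPGroup_zpowers hk
    have hgN : Subgroup.zpowers g ≤ Subgroup.normalizer (P : Set G) :=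
      (Subgroup.zpowers_le).2 (Subgroup.mem_normalizer_of_conj_mem hgP)
    have hperm := SubgroupsPermute.of_le_normalizer hgN
    set W := P ⊔ Subgroup.zpowers g with hW
    have hWN : W ≤ Subgroup.normalizer (P : Set G) := sup_le Subgroup.le_normalizer hgN
    have hWP : (P.subgroupOf W).Normal :=
      ⟨fun y hy z => Subgroup.mem_subgroupOf.2
        (Subgroup.normalizer_conj_mem (hWN z.2) (Subgroup.mem_subgroupOf.1 hy))⟩
    have hSP : (P.subgroupOf S).Normal :=
      ⟨fun y hy z => Subgroup.mem_subgroupOf.2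
        (Subgroup.normalizer_conj_mem (hWN (hSW z.2)) (Subgroup.mem_subgroupOf.1 hy))⟩
    have hpi : primeDivisors S ⊆ {p, q} := by
      intro r hr
      obtain ⟨hrp, hrd⟩ := mem_primeDivisors.1 hr
      have h1 := (hrd.trans (Subgroup.card_dvd_of_le hSW)).trans hperm.card_sup_dvd
      rcases (hrp.dvd_mul).1 h1 with h2 | h2
      · exact Or.inl (primeDivisors_subset_of_isPGroup hp hP (mem_primeDivisors.2 ⟨hrp, h2⟩))
      · exact Or.inr (primeDivisors_subset_of_isPGroup hq hZ (mem_primeDivisors.2 ⟨hrp, h2⟩))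
    have hmem : ∀ r s : ℕ, r.Prime → primeDivisors S ⊆ {r, s} → s ∈ primeDivisors S := by
      intro r s hr hrs
      by_contra hns
      have := Fact.mk hr
      refine hS.1 (isPGroup_of_primeDivisors_subset (p := r) fun t ht => ?_).isNilpotent
      rcases hrs ht with h1 | h1
      · exact h1
      · exact absurd (h1 ▸ ht) hns
    have hindW : ¬ p ∣ (P.subgroupOf W).index := by
      change ¬ p ∣ P.relIndex W
      have h1 := hperm.symm.relIndex_sup
      rw [sup_comm] at h1
      rw [hW, h1]
      intro hd
      exact hpq (primeDivisors_subset_of_isPGroup hq hZ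
        (mem_primeDivisors.2 ⟨hp, hd.trans (Subgroup.relIndex_dvd_card _ _)⟩))
    have hindS : ¬ p ∣ (P.subgroupOf S).index := by
      refine Subgroup.not_dvd_index_of_forall_mem hp ?_
      rintro ⟨s, hs⟩ ⟨l, hl⟩
      have h1 := Subgroup.mem_of_not_dvd_index (g := (⟨s, hSW hs⟩ : W)) (k := l) hp hindW
        (Subtype.ext (congrArg (fun z : S => (z : G)) hl))
      exact Subgroup.mem_subgroupOf.2 (Subgroup.mem_subgroupOf.1 h1)
    have hPS : IsPGroup p (P.subgroupOf S) := hP.comap_subtype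
    refine ⟨S, hS, ?_, hPS.toSylow hindS, hSP⟩
    refine Set.Subset.antisymm hpi ?_
    rintro r (rfl | rfl)
    · exact hmem q r hq (by rwa [Set.pair_comm])
    · exact hmem p r hp hpi

end Schmidt

/-! ### Translation into edges, and the theorem. -/

section Graphs

variable {G : Type*} [Group G] [Finite G] {A B : Subgroup G} {p q : ℕ}

theorem primeDivisors_subgroup_subset (H : Subgroup G) : primeDivisors H ⊆ primeDivisors G := by
  intro r hr
  obtain ⟨h1, h2⟩ := mem_primeDivisors.1 hr
  exact mem_primeDivisors.2 ⟨h1, h2.trans H.card_subgroup_dvd_card⟩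

theorem IsMutuallyPermutableProduct.primeDivisors_subset (h : IsMutuallyPermutableProduct A B) :
    primeDivisors G ⊆ primeDivisors A ∪ primeDivisors B := by
  intro r hr
  obtain ⟨h1, h2⟩ := mem_primeDivisors.1 hr
  rcases (h1.dvd_mul).1 (h2.trans h.card_dvd) with h3 | h3
  · exact Or.inl (mem_primeDivisors.2 ⟨h1, h3⟩)
  · exact Or.inr (mem_primeDivisors.2 ⟨h1, h3⟩)

/-- If q ∣ p - 1 and each factor has order divisible by p or q, then p and q can be assigned to
different factors, because each of them divides |A| or |B|. -/
theorem IsMutuallyPermutableProduct.mem_productGraph (h : IsMutuallyPermutableProduct A B)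
    (hp : p ∈ primeDivisors G) (hq : q ∈ primeDivisors G) (hlink : ¬ NotLinked p q A B) :
    (p, q) ∈ (productGraph A B).edges := by
  have hpp := (mem_primeDivisors.1 hp).1
  have hqp := (mem_primeDivisors.1 hq).1
  have hp' := h.primeDivisors_subset hp
  have hq' := h.primeDivisors_subset hq
  have hiff : ∀ (r : ℕ) (C : Subgroup G), r.Prime → (r ∈ primeDivisors C ↔ r ∣ Nat.card C) :=
    fun r C hr => mem_primeDivisors.trans (and_iff_right hr)
  rw [Set.mem_union, hiff p A hpp, hiff p B hpp] at hp'
  rw [Set.mem_union, hiff q A hqp, hiff q B hqp] at hq'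
  unfold NotLinked at hlink
  have hpf : q ∣ p - 1 → q ∈ (p - 1).primeFactors := fun hd =>
    Nat.mem_primeFactors.2 ⟨hqp, hd, (Nat.sub_pos_of_lt hpp.one_lt).ne'⟩
  change (p ∈ primeDivisors A ∧ q ∈ primeDivisors B ∧ q ∈ (p - 1).primeFactors) ∨
    (p ∈ primeDivisors B ∧ q ∈ primeDivisors A ∧ q ∈ (p - 1).primeFactors)
  rw [hiff p A hpp, hiff p B hpp, hiff q A hqp, hiff q B hqp]
  tauto

theorem mem_edges_hawkesGraph : (p, q) ∈ (hawkesGraph G).edges ↔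
    p ∈ primeDivisors G ∧ q.Prime ∧ q ∣ (opPrimePCore p G).index :=
  and_congr_right fun _ => mem_primeDivisors

theorem mem_edges_hawkesGraph_of_ne (hp : p.Prime) (hq : q.Prime) (hpq : p ≠ q) :
    (p, q) ∈ (hawkesGraph G).edges ↔ ¬ IsPPrimeByQPrime p q G := by
  rw [mem_edges_hawkesGraph, dvd_index_opPrimePCore_iff hp hq hpq]
  refine ⟨fun h => h.2.2, fun h => ⟨?_, hq, h⟩⟩
  by_contra hpG
  refine h ⟨⊤, inferInstance, ?_, ?_⟩
  · rw [Subgroup.card_top]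
    exact fun hd => hpG (mem_primeDivisors.2 ⟨hp, hd⟩)
  · rw [Subgroup.index_top]
    exact hq.not_dvd_one

/-- Argued with the index of O_{p',p} directly, which covers loops too. -/
theorem hawkesGraph_edges_subset (H : Subgroup G) : (hawkesGraph H).edges ⊆ (hawkesGraph G).edges := by
  rintro ⟨p, q⟩ he
  obtain ⟨h1, h2, h3⟩ := mem_edges_hawkesGraph.1 he
  exact mem_edges_hawkesGraph.2 ⟨primeDivisors_subgroup_subset H h1, h2,
    h3.trans (index_opPrimePCore_subgroup_dvd (mem_primeDivisors.1 h1).1 H)⟩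

theorem nCriticalGraph_edges_subset (H : Subgroup G) :
    (nCriticalGraph H).edges ⊆ (nCriticalGraph G).edges := by
  rintro ⟨p, q⟩ he
  obtain ⟨hp, hq, hpq, h⟩ := exists_isSchmidtPQGroup_iff.1 he
  exact exists_isSchmidtPQGroup_iff.2 ⟨hp, hq, hpq, fun h' => h (h'.subgroup H)⟩

end Graphs

theorem theorem3 {G : Type*} [Group G] [Finite G] (A B : Subgroup G)
    (hAB : IsMutuallyPermutableProduct A B) :
    (nCriticalGraph A ∪ nCriticalGraph B ⊆ nCriticalGraph G ∧
      nCriticalGraph G ⊆ nCriticalGraph A ∪ nCriticalGraph B ∪ productGraph A B) ∧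
    (hawkesGraph A ∪ hawkesGraph B ⊆ hawkesGraph G ∧
      hawkesGraph G ⊆ hawkesGraph A ∪ hawkesGraph B ∪ productGraph A B ∪ loopGraph G) := by
  have hverts := hAB.primeDivisors_subset
  have hverts' : primeDivisors A ∪ primeDivisors B ⊆ primeDivisors G :=
    Set.union_subset (primeDivisors_subgroup_subset A) (primeDivisors_subgroup_subset B)
  refine ⟨⟨⟨hverts', ?_⟩, ⟨fun r hr => Or.inl (hverts hr), ?_⟩⟩,
    ⟨⟨hverts', ?_⟩, ⟨fun r hr => Or.inl (Or.inl (hverts hr)), ?_⟩⟩⟩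
  · exact Set.union_subset (nCriticalGraph_edges_subset A) (nCriticalGraph_edges_subset B)
  · rintro ⟨p, q⟩ he
    obtain ⟨hpG, hqG⟩ := (nCriticalGraph G).edges_mem _ he
    obtain ⟨hp, hq, hpq, h⟩ := exists_isSchmidtPQGroup_iff.1 he
    by_cases hA : QElementsCentralize p q A
    · by_cases hB : QElementsCentralize p q B
      · refine Or.inr (hAB.mem_productGraph hpG hqG fun hlink => h ?_)
        exact qElementsCentralize_of_mutuallyPermutable hp hq hpq _ G A B rfl hAB hlink hA hB
      · exact Or.inl (Or.inr (exists_isSchmidtPQGroup_iff.2 ⟨hp, hq, hpq, hB⟩))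
    · exact Or.inl (Or.inl (exists_isSchmidtPQGroup_iff.2 ⟨hp, hq, hpq, hA⟩))
  · exact Set.union_subset (hawkesGraph_edges_subset A) (hawkesGraph_edges_subset B)
  · rintro ⟨p, q⟩ he
    obtain ⟨hpG, hqG⟩ := (hawkesGraph G).edges_mem _ he
    have hp := (mem_primeDivisors.1 hpG).1
    have hq := (mem_primeDivisors.1 hqG).1
    by_cases hpq : p = q
    · exact Or.inr ⟨hpG, hpq.symm⟩
    have h := (mem_edges_hawkesGraph_of_ne hp hq hpq).1 he
    left
    by_cases hA : IsPPrimeByQPrime p q A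
    · by_cases hB : IsPPrimeByQPrime p q B
      · refine Or.inr (hAB.mem_productGraph hpG hqG fun hlink => h ?_)
        exact isPPrimeByQPrime_of_mutuallyPermutable hp hq hpq _ G A B rfl hAB hlink hA hB
      · exact Or.inl (Or.inr ((mem_edges_hawkesGraph_of_ne hp hq hpq).2 hB))
    · exact Or.inl (Or.inl ((mem_edges_hawkesGraph_of_ne hp hq hpq).2 hA))
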